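/- **Model.** For $T\in\mathbb N$ let $X_t=f_t+\epsilon_t$, $t=1,\dots,T$, with $\epsilon_t$ i.i.d. $N(0,1)$ and a deterministic signal $f=f^{(T)}$ that may depend on $T$. Its change points $\eta_1<\dots<\eta_N$ are the $t\in\{1,\dots,T-1\}$ with $f_{t+1}\ne f_t$; put $\eta_0=0$, $\eta_{N+1}=T$, $\delta_i=|f_{\eta_i+1}-f_{\eta_i}|$, $\delta_*=\min_{1\le i\le N}\delta_i$ and $\lambda=\min_{0\le i\le N}(\eta_{i+1}-\eta_i)$. For $C>0$ let $(\mathrm A_C)$ be the condition $\delta_*^2\lambda\ge C\log T$ (no condition if $N=0$). **Procedure.** For a decay $a\in[1/2,1)$ and $1\le k\le\lceil\log_{1/a}T\rceil$ put $n_k=2\lceil(1/a)^{k-1}\rceil-1$, $l_k=Ta^{k-1}$, $s_k=(T-l_k)/(n_k-1)$ ($s_1:=0$). The seeded intervals are $(\lfloor(i-1)s_k\rfloor,\lceil(i-1)s_k+l_k\rceil]$, $1\le i\le n_k$, over all these $k$; those with fewer than $m$ observations are dropped, where $m\ge2$ is a given minimal segment length. For an interval $(\ell,r]$ and $s\in\{\ell+1,\dots,r-1\}$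 let $$T_{(\ell,r]}(s)=\sqrt{\tfrac{r-s}{(r-\ell)(s-\ell)}}\sum_{t=\ell+1}^sX_t-\sqrt{\tfrac{s-\ell}{(r-\ell)(r-s)}}\sum_{t=s+1}^rX_t ,$$ and let $\hat s_{(\ell,r]}$ be a maximiser of $|T_{(\ell,r]}(\cdot)|$. Narrowest-over-threshold selection with threshold $\kappa$ keeps the intervals with $|T_{(\ell,r]}(\hat s_{(\ell,r]})|>\kappa$, takes a shortest one of them, records its $\hat s_{(\ell,r]}$ as an estimated change point, discards all intervals $(\ell',r']$ with $\ell'<\hat s_{(\ell,r]}\le r'$, and repeats this with the remaining intervals until none is left; ties are broken arbitrarily. Let $\hat\eta_1<\dots<\hat\eta_{\hat N}$ be the estimated change points. **Theorem.** 1. There are absolute constants $C_0,C_1,C_2>0$ (in particular independent of $T$ and $a$) such that the following holds for every $a\in[1/2,1)$, all $m=m_T\ge2$ and all signals $f=f^{(T)}$ such that, for all large $T$, $(\mathrm A_{C_0})$ holds and $m\le a\lambda+1$ (for $m=2$ this says $\lambda\ge2$): with the threshold $\kappa=C_1\log^{1/2}T$, as $T\to\infty$, $$\Pr\Big\{\hat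 N=N,\ \max_{1\le i\le N}\delta_i^2|\hat\eta_i-\eta_i|\le C_2\log T\Big\}\to1,$$ where the event is that these relations hold for every way of breaking ties. 2. The rates are minimax optimal up to constants: (i) there are $c_0>0$ and $p<1$ such that, for all large $T$ and every measurable estimator $\hat N$ of the number of change points based on $X_1,\dots,X_T$, some signal with $\lambda\ge2$ satisfies $(\mathrm A_{c_0})$ and $\Pr\{\hat N=N\}\le p$; (ii) there are $c_2>0$ and $p<1$ such that for every $C>0$, all large $T$ and every measurable estimator $\{\hat\eta_1<\dots<\hat\eta_{\hat N}\}$ of the set of change points, some signal with $\lambda\ge2$ satisfies $(\mathrm A_{C})$ and $\Pr\{\hat N=N,\ \max_{1\le i\le N}\delta_i^2|\hat\eta_i-\eta_i|\le c_2\log T\}\le p$. -/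

import Mathlib

noncomputable section

namespace SeededBS

/-- The time points `1, …, T`. -/
abbrev Obs (T : ℕ) : Type := {t : ℕ // t ∈ Finset.Icc 1 T}

/-- The law of `(X_1, …, X_T)` where `X_t = f_t + ε_t` with `ε_t` i.i.d. standard Gaussian:
the product of the laws `N(f_t, 1)`. -/
def law (T : ℕ) (f : ℕ → ℝ) : MeasureTheory.Measure (Obs T → ℝ) :=
  MeasureTheory.Measure.pi fun t => ProbabilityTheory.gaussianReal (f t.1) 1

/-! ### The signal -/

open Classical in
/-- The change points of the signal `f_1, …, f_T`. -/
def changePoints (T : ℕ) (f : ℕ → ℝ) : Finset ℕ :=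
  (Finset.Ico 1 T).filter fun t => f (t + 1) ≠ f t

/-- The number `N` of change points. -/
def numChanges (T : ℕ) (f : ℕ → ℝ) : ℕ := (changePoints T f).card

/-- For a finite set `S` of locations, `loc T S 0 = 0`, `loc T S i` is the `i`-th smallest element
of `S` for `1 ≤ i ≤ #S`, and `loc T S (#S + 1) = T`. -/
def loc (T : ℕ) (S : Finset ℕ) : ℕ → ℕ
  | 0 => 0
  | i + 1 => (S.sort (· ≤ ·)).getD i T

/-- `η_i`, including `η_0 = 0` and `η_{N+1} = T`. -/
def eta (T : ℕ) (f : ℕ → ℝ) (i : ℕ) : ℕ := loc T (changePoints T f) i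

/-- The jump size `δ_i` at the `i`-th change point, `1 ≤ i ≤ N`. -/
def jump (T : ℕ) (f : ℕ → ℝ) (i : ℕ) : ℝ := |f (eta T f i + 1) - f (eta T f i)|

/-- The minimal jump `δ_*` (only used for `N > 0`). -/
def minJump (T : ℕ) (f : ℕ → ℝ) : ℝ := ⨅ i : Fin (numChanges T f), jump T f (i.1 + 1)

/-- The minimal spacing `λ`, over `i = 0, …, N`. -/
def minSpacing (T : ℕ) (f : ℕ → ℝ) : ℕ :=
  (Finset.range (numChanges T f + 1)).inf' ⟨0, by simp⟩ fun i => eta T f (i + 1) - eta T f i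

/-- `δ_*² λ ≥ C log T` (no condition if there is no change point). -/
def Detectable (C : ℝ) (T : ℕ) (f : ℕ → ℝ) : Prop :=
  0 < numChanges T f → C * Real.log T ≤ minJump T f ^ 2 * (minSpacing T f : ℝ)

/-- The set `S` of estimates has the right cardinality, and `δ_i² |η̂_i - η_i| ≤ B` for
`i = 1, …, N`. -/
def Accurate (T : ℕ) (f : ℕ → ℝ) (S : Finset ℕ) (B : ℝ) : Prop :=
  S.card = numChanges T f ∧
    ∀ i ∈ Finset.Icc 1 (numChanges T f),
      jump T f i ^ 2 * |(loc T S i : ℝ) - (eta T f i : ℝ)| ≤ B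

/-! ### Seeded intervals; the pair `(l, r)` stands for the interval `(l, r]` -/

/-- The number `n_k` of intervals in the `k`-th layer. -/
def layerCount (a : ℝ) (k : ℕ) : ℕ := 2 * ⌈(1 / a) ^ (k - 1)⌉₊ - 1

/-- The length `l_k`. -/
def layerLength (a : ℝ) (T k : ℕ) : ℝ := (T : ℝ) * a ^ (k - 1)

/-- The shift `s_k` (irrelevant for `k = 1`, where there is a single interval). -/
def layerShift (a : ℝ) (T k : ℕ) : ℝ :=
  ((T : ℝ) - layerLength a T k) / ((layerCount a k : ℝ) - 1)

/-- The `k`-th layer. -/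
def layer (a : ℝ) (T k : ℕ) : Finset (ℕ × ℕ) :=
  (Finset.Icc 1 (layerCount a k)).image fun i : ℕ =>
    (⌊((i : ℝ) - 1) * layerShift a T k⌋₊,
      ⌈((i : ℝ) - 1) * layerShift a T k + layerLength a T k⌉₊)

/-- The collection of all seeded intervals with decay `a`. -/
def seededIntervals (a : ℝ) (T : ℕ) : Finset (ℕ × ℕ) :=
  (Finset.Icc 1 ⌈Real.logb (1 / a) T⌉₊).biUnion fun k => layer a T k

/-! ### CUSUM statistics and narrowest-over-threshold selection -/

/-- The CUSUM statistic of the interval `(I.1, I.2]` at the split point `s`. -/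
def cusum {T : ℕ} (x : Obs T → ℝ) (I : ℕ × ℕ) (s : ℕ) : ℝ :=
  √(((I.2 : ℝ) - s) / (((I.2 : ℝ) - I.1) * ((s : ℝ) - I.1))) *
      (∑ t : Obs T with I.1 < t.1 ∧ t.1 ≤ s, x t) -
    √(((s : ℝ) - I.1) / (((I.2 : ℝ) - I.1) * ((I.2 : ℝ) - s))) *
      (∑ t : Obs T with s < t.1 ∧ t.1 ≤ I.2, x t)

/-- `s` maximises the absolute CUSUM statistic over `I.1 + 1, …, I.2 - 1`. -/
def IsBestSplit {T : ℕ} (x : Obs T → ℝ) (I : ℕ × ℕ) (s : ℕ) : Prop :=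
  s ∈ Finset.Ioo I.1 I.2 ∧ ∀ s' ∈ Finset.Ioo I.1 I.2, |cusum x I s'| ≤ |cusum x I s|

/-- The maximal absolute CUSUM statistic of the interval exceeds `κ`. -/
def OverThreshold {T : ℕ} (κ : ℝ) (x : Obs T → ℝ) (I : ℕ × ℕ) : Prop :=
  ∃ s, IsBestSplit x I s ∧ κ < |cusum x I s|

/-- `NarrowestRun x A S`: starting from the set `A` of active intervals, repeatedly picking a
narrowest active interval, recording a best split of it and discarding all active intervals that
contain this split can result in the set `S` of recorded points. Ties are broken arbitrarily. -/
inductive NarrowestRun {T : ℕ} (x : Obs T → ℝ) : Finset (ℕ × ℕ) → Finset ℕ → Prop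
  | done : NarrowestRun x ∅ ∅
  | step (A : Finset (ℕ × ℕ)) (I : ℕ × ℕ) (s : ℕ) (S : Finset ℕ)
      (hI : I ∈ A) (hmin : ∀ J ∈ A, I.2 - I.1 ≤ J.2 - J.1) (hs : IsBestSplit x I s)
      (hrun : NarrowestRun x (A.filter fun J => ¬ (J.1 < s ∧ s ≤ J.2)) S) :
      NarrowestRun x A (insert s S)

open Classical in
/-- `S` is a possible set of estimated change points of seeded binary segmentation with decay `a`,
minimal segment length `m` and narrowest-over-threshold selection with threshold `κ`. -/
def IsOutput {T : ℕ} (a : ℝ) (m : ℕ) (κ : ℝ) (x : Obs T → ℝ) (S : Finset ℕ) : Prop :=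
  NarrowestRun x
    ((seededIntervals a T).filter fun I => m ≤ I.2 - I.1 ∧ OverThreshold κ x I) S

/-- The procedure always produces an output. -/
theorem exists_isOutput {T : ℕ} (a : ℝ) (m : ℕ) (κ : ℝ) (x : Obs T → ℝ) :
    ∃ S, IsOutput a m κ x S := by
  classical
  have key : ∀ n : ℕ, ∀ A : Finset (ℕ × ℕ), A.card = n →
      (∀ I ∈ A, ∃ s, IsBestSplit x I s) → ∃ S, NarrowestRun x A S := by
    intro n
    induction n using Nat.strong_induction_on with
    | _ n ih =>
      intro A hA hb
      rcases A.eq_empty_or_nonempty with rfl | hne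
      · exact ⟨∅, .done⟩
      · obtain ⟨I, hI, hmin⟩ := A.exists_min_image (fun J => J.2 - J.1) hne
        obtain ⟨s, hs⟩ := hb I hI
        have hlt : (A.filter fun J => ¬ (J.1 < s ∧ s ≤ J.2)).card < n := by
          rw [← hA]
          apply Finset.card_lt_card
          rw [Finset.filter_ssubset]
          have := Finset.mem_Ioo.1 hs.1
          exact ⟨I, hI, not_not.2 ⟨this.1, this.2.le⟩⟩
        obtain ⟨S, hS⟩ := ih _ hlt _ rfl fun J hJ => hb J (Finset.mem_filter.1 hJ).1
        exact ⟨insert s S, .step A I s S hI hmin hs hS⟩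
  refine key _ _ rfl fun I hI => ?_
  obtain ⟨s, hs, -⟩ := (Finset.mem_filter.1 hI).2.2
  exact ⟨s, hs⟩

end SeededBS

end

open SeededBS Filter

/-!
On an event of probability tending to one, every sum of the noise over a block of length `n` is at
most `M √n` in absolute value, where `M` is of order `√(log T)`. On this event an interval whose
statistic exceeds the threshold has a change point `x` of which it contains all estimates with error
`O(log T / δ²)`: up to its changes near the two ends the signal would otherwise be constant.
Conversely each change point lies well inside a seeded interval of length at most the spacing
(up to rounding) which exceeds the threshold and contains no estimate of another change point. It is
therefore not discarded before its change point is estimated, and since selection prefers narrow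
intervals, every selected interval is that short, so it contains exactly one change point and
estimates it for the first time. The error is `O(log T / δ²)` because the statistic at the estimate
is at least that at the change point: the energy which the signal part loses between the two is
bounded by the energy of the noise in between.

For the lower bounds, a signal is compared with the uniform mixture of about `T` perturbations whose
likelihood ratios are uncorrelated with second moment at most their number, so that the mixture is
at bounded `χ²`-distance from the signal. An estimator that is right for the signal is then wrong
for some perturbation: short bumps change the number of change points, and shifting one step of a
staircase moves one change point.
-/

namespace SeededBS

/-! ### Locations, spacings and jumps -/

section Locations

variable {T : ℕ} {S : Finset ℕ} {i j : ℕ}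

theorem loc_succ (i : Fin S.card) : loc T S (i + 1) = S.orderEmbOfFin rfl i := by
  have hi : (i : ℕ) < (S.sort (· ≤ ·)).length := by simp
  simp only [loc, Finset.orderEmbOfFin_apply]
  rw [List.getD_eq_getElem _ _ hi]
  rfl

theorem loc_succ_mem (hi : i < S.card) : loc T S (i + 1) ∈ S := by
  rw [loc_succ ⟨i, hi⟩]
  exact Finset.orderEmbOfFin_mem _ _ _

theorem loc_card_succ : loc T S (S.card + 1) = T := by
  simp [loc]

theorem exists_loc_eq {x : ℕ} (hx : x ∈ S) : ∃ i < S.card, loc T S (i + 1) = x := by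
  obtain ⟨i, rfl⟩ : x ∈ Set.range (S.orderEmbOfFin rfl) := by simpa using hx
  exact ⟨i, i.2, loc_succ i⟩

theorem loc_lt_loc (hij : i < j) (hj : j < S.card) : loc T S (i + 1) < loc T S (j + 1) := by
  rw [loc_succ ⟨i, hij.trans hj⟩, loc_succ ⟨j, hj⟩]
  exact (S.orderEmbOfFin rfl).strictMono hij

theorem loc_eq_of_strictMono {n : ℕ} (hS : S.card = n) (g : Fin n → ℕ) (hg : StrictMono g)
    (hmem : ∀ i, g i ∈ S) (i : Fin n) : loc T S (i + 1) = g i := by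
  subst hS
  rw [loc_succ, ← Finset.orderEmbOfFin_unique rfl hmem hg]

theorem loc_image {σ : ℕ → ℕ} (hσ : StrictMonoOn σ S) (hi : i < S.card) :
    loc T (S.image σ) (i + 1) = σ (loc T S (i + 1)) := by
  have hcard : (S.image σ).card = S.card := Finset.card_image_of_injOn hσ.injOn
  rw [loc_eq_of_strictMono hcard (fun j => σ (loc T S (j + 1))) _ _ ⟨i, hi⟩]
  · intro j k hjk
    exact hσ (loc_succ_mem j.2) (loc_succ_mem k.2) (loc_lt_loc hjk k.2)
  · intro j
    exact Finset.mem_image_of_mem _ (loc_succ_mem j.2)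

end Locations

section Signals

variable {T : ℕ} {f : ℕ → ℝ}

theorem mem_changePoints {t : ℕ} :
    t ∈ changePoints T f ↔ (1 ≤ t ∧ t < T) ∧ f (t + 1) ≠ f t := by
  simp [changePoints]

theorem eta_zero : eta T f 0 = 0 := rfl

theorem eta_numChanges_succ : eta T f (numChanges T f + 1) = T := loc_card_succ

theorem eta_succ_mem {i : ℕ} (hi : i < numChanges T f) : eta T f (i + 1) ∈ changePoints T f :=
  loc_succ_mem hi

theorem exists_eta_eq {x : ℕ} (hx : x ∈ changePoints T f) :
    ∃ i < numChanges T f, eta T f (i + 1) = x :=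
  exists_loc_eq hx

theorem eta_le_eta_succ {i : ℕ} (hi : i ≤ numChanges T f) : eta T f i ≤ eta T f (i + 1) := by
  rcases i with _ | i
  · exact Nat.zero_le _
  · rcases hi.eq_or_lt with h | h
    · rw [h, eta_numChanges_succ, ← h]
      exact (mem_changePoints.1 (eta_succ_mem hi)).1.2.le
    · exact (loc_lt_loc (Nat.lt_succ_self i) h).le

theorem eta_mono {i j : ℕ} (hij : i ≤ j) (hj : j ≤ numChanges T f + 1) :
    eta T f i ≤ eta T f j := by
  induction j, hij using Nat.le_induction with
  | base => exact le_rfl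
  | succ n _ ih => exact (ih (by lia)).trans (eta_le_eta_succ (by lia))

theorem eta_add_minSpacing_le {i j : ℕ} (hij : i < j) (hj : j ≤ numChanges T f + 1) :
    eta T f i + minSpacing T f ≤ eta T f j := by
  have hgap : minSpacing T f ≤ eta T f (i + 1) - eta T f i :=
    Finset.inf'_le _ (Finset.mem_range.2 (by lia))
  have hi : eta T f i ≤ eta T f (i + 1) := eta_le_eta_succ (by lia)
  have hj : eta T f (i + 1) ≤ eta T f j := eta_mono hij hj
  lia

theorem minSpacing_le_changePoint {x : ℕ} (hx : x ∈ changePoints T f) : minSpacing T f ≤ x := by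
  obtain ⟨i, hi, rfl⟩ := exists_eta_eq hx
  simpa only [eta_zero, zero_add] using eta_add_minSpacing_le i.succ_pos (by lia)

theorem changePoint_add_minSpacing_le {x : ℕ} (hx : x ∈ changePoints T f) :
    x + minSpacing T f ≤ T := by
  obtain ⟨i, hi, rfl⟩ := exists_eta_eq hx
  simpa only [eta_numChanges_succ] using eta_add_minSpacing_le (Nat.succ_lt_succ hi) le_rfl

theorem add_minSpacing_le {x y : ℕ} (hx : x ∈ changePoints T f) (hy : y ∈ changePoints T f)
    (hxy : x < y) : x + minSpacing T f ≤ y := by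
  obtain ⟨i, hi, rfl⟩ := exists_eta_eq hx
  obtain ⟨j, hj, rfl⟩ := exists_eta_eq hy
  refine eta_add_minSpacing_le ?_ (by lia)
  by_contra hji
  exact hxy.not_ge (eta_mono (not_lt.1 hji) (by lia))

theorem le_minSpacing {k : ℕ} (hT : k ≤ T)
    (hbdry : ∀ x ∈ changePoints T f, k ≤ x ∧ x + k ≤ T)
    (hsep : ∀ x ∈ changePoints T f, ∀ y ∈ changePoints T f, x < y → x + k ≤ y) :
    k ≤ minSpacing T f := by
  refine Finset.le_inf' _ _ fun i hi => ?_
  have hi : i ≤ numChanges T f := Nat.lt_succ_iff.1 (Finset.mem_range.1 hi)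
  rcases i with _ | i
  · rw [eta_zero, Nat.sub_zero]
    rcases hi.eq_or_lt with h | h
    · rwa [h, eta_numChanges_succ]
    · exact (hbdry _ (eta_succ_mem h)).1
  · refine Nat.le_sub_of_add_le' ?_
    rcases hi.eq_or_lt with h | h
    · rw [h, eta_numChanges_succ, ← h]
      exact (hbdry _ (eta_succ_mem hi)).2
    · exact hsep _ (eta_succ_mem hi) _ (eta_succ_mem h) (loc_lt_loc (Nat.lt_succ_self i) h)

theorem minJump_nonneg : 0 ≤ minJump T f :=
  Real.iInf_nonneg fun _ => abs_nonneg _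

theorem minJump_le {x : ℕ} (hx : x ∈ changePoints T f) : minJump T f ≤ |f (x + 1) - f x| := by
  obtain ⟨i, hi, rfl⟩ := exists_eta_eq hx
  exact ciInf_le (f := fun i : Fin (numChanges T f) => jump T f (i.1 + 1))
    (Set.finite_range _).bddBelow ⟨i, hi⟩

theorem le_minJump {c : ℝ} (hN : 0 < numChanges T f)
    (h : ∀ x ∈ changePoints T f, c ≤ |f (x + 1) - f x|) : c ≤ minJump T f := by
  have : Nonempty (Fin (numChanges T f)) := ⟨⟨0, hN⟩⟩
  exact le_ciInf fun i => h _ (eta_succ_mem i.2)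

theorem Detectable.le_jump_sq {C : ℝ} (h : Detectable C T f) {x : ℕ}
    (hx : x ∈ changePoints T f) :
    C * Real.log T ≤ (f (x + 1) - f x) ^ 2 * (minSpacing T f : ℝ) := by
  refine (h (Finset.card_pos.2 ⟨x, hx⟩)).trans ?_
  rw [← sq_abs (f (x + 1) - f x)]
  gcongr
  exacts [minJump_nonneg, minJump_le hx]

theorem detectable_of_forall_jump {C δ : ℝ} {k : ℕ} (hδ : 0 ≤ δ)
    (h : ∀ x ∈ changePoints T f, δ ≤ |f (x + 1) - f x|) (hk : k ≤ minSpacing T f)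
    (hC : C * Real.log T ≤ δ ^ 2 * k) : Detectable C T f := by
  intro hN
  have hδ_le : δ ≤ minJump T f := le_minJump hN h
  refine hC.trans ?_
  gcongr

theorem eq_of_no_changePoint {s t : ℕ} (hs : 1 ≤ s) (hst : s ≤ t) (ht : t ≤ T)
    (h : ∀ x ∈ changePoints T f, s ≤ x → t ≤ x) : f t = f s := by
  induction t, hst using Nat.le_induction with
  | base => rfl
  | succ n hn ih =>
    rw [← ih (by lia) fun x hx hsx => n.le_succ.trans (h x hx hsx)]
    by_contra hne
    exact (h n (mem_changePoints.2 ⟨⟨hs.trans hn, ht⟩, hne⟩) hn).not_gt n.lt_succ_self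

theorem accurate_image {B : ℝ} {σ : ℕ → ℕ}
    (hclose : ∀ x ∈ changePoints T f, 2 * |(σ x : ℝ) - x| < minSpacing T f)
    (hacc : ∀ x ∈ changePoints T f, (f (x + 1) - f x) ^ 2 * |(σ x : ℝ) - x| ≤ B) :
    Accurate T f ((changePoints T f).image σ) B := by
  have hmono : StrictMonoOn σ (changePoints T f) := by
    intro x hx y hy hxy
    have hsep : (x : ℝ) + minSpacing T f ≤ y := by exact_mod_cast add_minSpacing_le hx hy hxy
    have hσx := le_abs_self ((σ x : ℝ) - x)
    have hσy := neg_abs_le ((σ y : ℝ) - y)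
    have : (σ x : ℝ) < σ y := by linarith [hclose x hx, hclose y hy]
    exact_mod_cast this
  refine ⟨Finset.card_image_of_injOn hmono.injOn, fun i hi => ?_⟩
  obtain ⟨hi₁, hi₂⟩ := Finset.mem_Icc.1 hi
  obtain ⟨j, rfl⟩ := Nat.exists_eq_succ_of_ne_zero (Nat.one_le_iff_ne_zero.1 hi₁)
  rw [loc_image hmono hi₂, jump, sq_abs]
  exact hacc _ (eta_succ_mem hi₂)

end Signals

/-! ### Contrasts of adjacent blocks -/

section Contrast

variable {A B D R M : ℝ}

/-- The contrast of two adjacent blocks of lengths `A` and `R` whose entries sum to `x` and `y`,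
i.e. the inner product with the unit vector that is constant on each block and has mean zero. -/
noncomputable def contrast (A R x y : ℝ) : ℝ :=
  √(R / ((A + R) * A)) * x - √(A / ((A + R) * R)) * y

/-- The inner product of the two unit vectors which contrast the blocks after the first and after
the second of three adjacent blocks of lengths `A`, `B`, `D`. -/
noncomputable def similarity (A B D : ℝ) : ℝ := √(A * D / ((A + B) * (B + D)))

theorem contrast_eq (hA : 0 < A) (hR : 0 < R) (x y : ℝ) :
    contrast A R x y = √(A * R / (A + R)) * (x / A - y / R) := by
  have hx : √(R / ((A + R) * A)) = √(A * R / (A + R)) / A := by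
    rw [eq_div_iff hA.ne', ← Real.sqrt_mul_self hA.le, ← Real.sqrt_mul (by positivity),
      Real.sqrt_mul_self hA.le]
    congr 1; field_simp
  have hy : √(A / ((A + R) * R)) = √(A * R / (A + R)) / R := by
    rw [eq_div_iff hR.ne', ← Real.sqrt_mul_self hR.le, ← Real.sqrt_mul (by positivity),
      Real.sqrt_mul_self hR.le]
    congr 1; field_simp
  rw [contrast, hx, hy]; ring

theorem contrast_add (A R x y x' y' : ℝ) :
    contrast A R (x + x') (y + y') = contrast A R x y + contrast A R x' y' := by
  simp only [contrast]; ring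

theorem contrast_swap (A R x y : ℝ) : contrast R A y x = -contrast A R x y := by
  simp only [contrast, add_comm R A]; ring

theorem contrast_mul_mul (hA : 0 < A) (hR : 0 < R) (g g' : ℝ) :
    contrast A R (A * g) (R * g') = √(A * R / (A + R)) * (g - g') := by
  rw [contrast_eq hA hR, mul_div_cancel_left₀ _ hA.ne', mul_div_cancel_left₀ _ hR.ne']

theorem contrast_sq_le (hA : 0 < A) (hR : 0 < R) (x y : ℝ) :
    contrast A R x y ^ 2 ≤ x ^ 2 / A + y ^ 2 / R := by
  have hdefect : x ^ 2 / A + y ^ 2 / R - contrast A R x y ^ 2 = (x + y) ^ 2 / (A + R) := by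
    rw [contrast_eq hA hR, mul_pow, Real.sq_sqrt (by positivity)]
    field_simp; ring
  have : 0 ≤ (x + y) ^ 2 / (A + R) := by positivity
  linarith

theorem abs_contrast_le {x y : ℝ} (hA : 0 < A) (hR : 0 < R) (hM : 0 ≤ M)
    (hx : x ^ 2 ≤ M ^ 2 * A) (hy : y ^ 2 ≤ M ^ 2 * R) : |contrast A R x y| ≤ 3 / 2 * M := by
  refine abs_le_of_sq_le_sq ?_ (by positivity)
  have hxA : x ^ 2 / A ≤ M ^ 2 := (div_le_iff₀ hA).2 hx
  have hyR : y ^ 2 / R ≤ M ^ 2 := (div_le_iff₀ hR).2 hy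
  linarith [contrast_sq_le hA hR x y, sq_nonneg M]

theorem similarity_nonneg : 0 ≤ similarity A B D := Real.sqrt_nonneg _

theorem similarity_sq (hA : 0 < A) (hB : 0 < B) (hD : 0 < D) :
    similarity A B D ^ 2 = A * D / ((A + B) * (B + D)) :=
  Real.sq_sqrt (by positivity)

theorem similarity_le_one (hA : 0 < A) (hB : 0 < B) (hD : 0 < D) : similarity A B D ≤ 1 := by
  refine (sq_le_one_iff₀ similarity_nonneg).1 ?_
  rw [similarity_sq hA hB hD, div_le_one (by positivity)]
  have : 0 ≤ B * (A + B + D) := by positivity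
  linarith

theorem sqrt_mul_sqrt_eq_similarity (hA : 0 < A) (hB : 0 < B) (hD : 0 < D) :
    √(A * (B + D) / (A + (B + D))) * √((A + B) * D / (A + B + D)) =
      (A + B) * (B + D) / (A + B + D) * similarity A B D := by
  have h0 : 0 ≤ (A + B) * (B + D) / (A + B + D) := by positivity
  rw [similarity, ← Real.sqrt_sq h0, ← Real.sqrt_mul (sq_nonneg _),
    ← Real.sqrt_mul (by positivity)]
  congr 1; field_simp; ring

theorem contrast_first_eq_similarity_mul (hA : 0 < A) (hB : 0 < B) (hD : 0 < D) (g g' : ℝ) :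
    contrast A (B + D) (A * g) (B * g + D * g') =
      similarity A B D * contrast (A + B) D (A * g + B * g) (D * g') := by
  have hBD : 0 < B + D := by positivity
  have hw : √(A * (B + D) / (A + (B + D))) * D / (B + D) =
      similarity A B D * √((A + B) * D / (A + B + D)) := by
    have h₂ : 0 < √((A + B) * D / (A + B + D)) := by positivity
    have h₂_sq : √((A + B) * D / (A + B + D)) ^ 2 = (A + B) * D / (A + B + D) :=
      Real.sq_sqrt (by positivity)
    refine mul_right_cancel₀ h₂.ne' ?_
    calc √(A * (B + D) / (A + (B + D))) * D / (B + D) * √((A + B) * D / (A + B + D))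
        = √(A * (B + D) / (A + (B + D))) * √((A + B) * D / (A + B + D)) * (D / (B + D)) := by ring
      _ = similarity A B D * ((A + B) * D / (A + B + D)) := by
        rw [sqrt_mul_sqrt_eq_similarity hA hB hD]; field_simp
      _ = similarity A B D * √((A + B) * D / (A + B + D)) * √((A + B) * D / (A + B + D)) := by
        rw [mul_assoc, ← sq, h₂_sq]
  rw [← add_mul, contrast_mul_mul (by positivity) hD, contrast_eq hA hBD, ← mul_assoc, ← hw]
  field_simp; ring

theorem sq_add_le_mul_div (hA : 0 < A) (hB : 0 < B) (hD : 0 < D) (α β γ a b d : ℝ) :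
    (α * a + β * b + γ * d) ^ 2 ≤
      (A * α ^ 2 + B * β ^ 2 + D * γ ^ 2) * (a ^ 2 / A + b ^ 2 / B + d ^ 2 / D) := by
  have hCS := Finset.sum_sq_le_sum_mul_sum_of_sq_le_mul Finset.univ
    (f := ![A * α ^ 2, B * β ^ 2, D * γ ^ 2]) (g := ![a ^ 2 / A, b ^ 2 / B, d ^ 2 / D])
    (r := ![α * a, β * b, γ * d])
    (fun i _ => by
      fin_cases i
      exacts [show 0 ≤ A * α ^ 2 by positivity, show 0 ≤ B * β ^ 2 by positivity,
        show 0 ≤ D * γ ^ 2 by positivity])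
    (fun i _ => by
      fin_cases i
      exacts [show 0 ≤ a ^ 2 / A by positivity, show 0 ≤ b ^ 2 / B by positivity,
        show 0 ≤ d ^ 2 / D by positivity])
    (by intro i _; fin_cases i <;> exact le_of_eq (by simp; field_simp))
  simpa [Fin.sum_univ_three] using hCS

/-- The squared norm of the difference of two unit vectors with inner product `ρ` is
`2 * (1 - ρ)`. -/
theorem contrast_sub_contrast_sq_le (hA : 0 < A) (hB : 0 < B) (hD : 0 < D) (a b d : ℝ) :
    (contrast A (B + D) a (b + d) - contrast (A + B) D (a + b) d) ^ 2 ≤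
      2 * (1 - similarity A B D) * (a ^ 2 / A + b ^ 2 / B + d ^ 2 / D) := by
  have hAB : 0 < A + B := by positivity
  have hBD : 0 < B + D := by positivity
  have hprod := sqrt_mul_sqrt_eq_similarity hA hB hD
  have h₁_sq : √(A * (B + D) / (A + (B + D))) ^ 2 = A * (B + D) / (A + (B + D)) :=
    Real.sq_sqrt (by positivity)
  have h₂_sq : √((A + B) * D / (A + B + D)) ^ 2 = (A + B) * D / (A + B + D) :=
    Real.sq_sqrt (by positivity)
  rw [contrast_eq hA hBD, contrast_eq hAB hD]
  set w₁ := √(A * (B + D) / (A + (B + D)))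
  set w₂ := √((A + B) * D / (A + B + D))
  have hnorm : A * (w₁ / A - w₂ / (A + B)) ^ 2 + B * (-(w₁ / (B + D) + w₂ / (A + B))) ^ 2 +
      D * (w₂ / D - w₁ / (B + D)) ^ 2 = 2 * (1 - similarity A B D) := by
    calc _ = w₁ ^ 2 * (1 / A + 1 / (B + D)) + w₂ ^ 2 * (1 / (A + B) + 1 / D) -
          2 * (w₁ * w₂ * ((A + B + D) / ((A + B) * (B + D)))) := by field_simp; ring
      _ = _ := by rw [h₁_sq, h₂_sq, hprod]; field_simp; ring
  rw [← hnorm]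
  refine le_trans (le_of_eq ?_) (sq_add_le_mul_div hA hB hD _ _ _ a b d)
  congr 1; field_simp; ring

theorem contrast_sub_contrast_sq_le_mul {a b d : ℝ} (hA : 0 < A) (hB : 0 < B) (hD : 0 < D)
    (ha : a ^ 2 ≤ M ^ 2 * A) (hb : b ^ 2 ≤ M ^ 2 * B) (hd : d ^ 2 ≤ M ^ 2 * D) :
    (contrast A (B + D) a (b + d) - contrast (A + B) D (a + b) d) ^ 2 ≤
      6 * M ^ 2 * (1 - similarity A B D) := by
  refine (contrast_sub_contrast_sq_le hA hB hD a b d).trans ?_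
  have : a ^ 2 / A + b ^ 2 / B + d ^ 2 / D ≤ 3 * M ^ 2 := by
    linarith [(div_le_iff₀ hA).2 ha, (div_le_iff₀ hB).2 hb, (div_le_iff₀ hD).2 hd]
  have hρ : 0 ≤ 1 - similarity A B D := sub_nonneg.2 (similarity_le_one hA hB hD)
  linarith [mul_le_mul_of_nonneg_left this hρ]

/-- Here `Δ + v` is the statistic at the true change, where the signal part is largest, and
`Δ * ρ + u` is the statistic at the maximiser. Dividing `Δ * (1 - ρ) ≤ |u - v|`, once squared, by
`1 - ρ` bounds the loss of energy by that of the noise. -/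
theorem energy_loss_le {Δ ρ u v : ℝ} (hρ₀ : 0 ≤ ρ) (hρ₁ : ρ ≤ 1) (hM : 0 ≤ M)
    (hu : |u| ≤ 3 / 2 * M) (huv : (u - v) ^ 2 ≤ 6 * M ^ 2 * (1 - ρ))
    (hmax : |Δ + v| ≤ |Δ * ρ + u|) (hbig : 10 * M < |Δ * ρ + u|) :
    Δ ^ 2 * (1 - ρ ^ 2) ≤ 12 * M ^ 2 ∧ 24 * M ^ 2 < Δ ^ 2 := by
  wlog hΔ : 0 ≤ Δ generalizing Δ u v
  · rw [← neg_sq Δ]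
    refine this (u := -u) (v := -v) (by rwa [abs_neg]) (by linarith) ?_ ?_ (by linarith)
    · rwa [neg_mul, ← neg_add, ← neg_add, abs_neg, abs_neg]
    · rwa [neg_mul, ← neg_add, abs_neg]
  have hu := abs_le.1 hu
  have hpos : 0 ≤ Δ * ρ + u := by
    by_contra hneg
    rw [abs_of_neg (not_le.1 hneg)] at hbig
    linarith [mul_nonneg hΔ hρ₀]
  rw [abs_of_nonneg hpos] at hmax hbig
  have hΔ_big : 17 / 2 * M < Δ := by linarith [mul_le_of_le_one_right hΔ hρ₁]
  refine ⟨?_, by nlinarith⟩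
  have hloss : (Δ * (1 - ρ)) ^ 2 ≤ 6 * M ^ 2 * (1 - ρ) := by
    refine (pow_le_pow_left₀ (mul_nonneg hΔ (by linarith)) ?_ 2).trans huv
    linarith [le_abs_self (Δ + v)]
  rcases hρ₁.eq_or_lt with rfl | hlt
  · rw [one_pow, sub_self, mul_zero]
    positivity
  · have hloss' : Δ ^ 2 * (1 - ρ) ≤ 6 * M ^ 2 :=
      le_of_mul_le_mul_right (by linarith) (sub_pos.2 hlt)
    calc Δ ^ 2 * (1 - ρ ^ 2) = Δ ^ 2 * (1 - ρ) * (1 + ρ) := by ring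
      _ ≤ 6 * M ^ 2 * (1 + 1) := by gcongr
      _ = 12 * M ^ 2 := by ring

/-- Three adjacent blocks of lengths `A`, `B`, `D` carry the means `g`, `g`, `g'`. -/
theorem jump_sq_mul_le_of_contrast_le {g g' a b d : ℝ} (hA : 0 < A) (hB : 0 < B) (hD : 0 < D)
    (hM : 0 ≤ M) (ha : a ^ 2 ≤ M ^ 2 * A) (hb : b ^ 2 ≤ M ^ 2 * B) (hd : d ^ 2 ≤ M ^ 2 * D)
    (hbd : (b + d) ^ 2 ≤ M ^ 2 * (B + D))
    (hmax : |contrast (A + B) D (A * g + a + (B * g + b)) (D * g' + d)| ≤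
      |contrast A (B + D) (A * g + a) (B * g + b + (D * g' + d))|)
    (hbig : 10 * M < |contrast A (B + D) (A * g + a) (B * g + b + (D * g' + d))|) :
    (g - g') ^ 2 * B ≤ 24 * M ^ 2 := by
  have hBD : 0 < B + D := by positivity
  have hfirst : contrast A (B + D) (A * g + a) (B * g + b + (D * g' + d)) =
      contrast (A + B) D (A * g + B * g) (D * g') * similarity A B D +
        contrast A (B + D) a (b + d) := by
    rw [add_add_add_comm, contrast_add, contrast_first_eq_similarity_mul hA hB hD, mul_comm]
  have hsecond : contrast (A + B) D (A * g + a + (B * g + b)) (D * g' + d) =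
      contrast (A + B) D (A * g + B * g) (D * g') + contrast (A + B) D (a + b) d := by
    rw [add_add_add_comm, contrast_add]
  rw [hfirst] at hmax hbig
  rw [hsecond] at hmax
  obtain ⟨hloss, hΔ⟩ := energy_loss_le similarity_nonneg (similarity_le_one hA hB hD) hM
    (abs_contrast_le hA hBD hM ha hbd) (contrast_sub_contrast_sq_le_mul hA hB hD ha hb hd)
    hmax hbig
  have hΔ_sq : contrast (A + B) D (A * g + B * g) (D * g') ^ 2 =
      (A + B) * D / (A + B + D) * (g - g') ^ 2 := by
    rw [← add_mul, contrast_mul_mul (by positivity) hD, mul_pow, Real.sq_sqrt (by positivity)]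
  have hloss' : (g - g') ^ 2 * (B * D) ≤ 12 * M ^ 2 * (B + D) := by
    rw [hΔ_sq, similarity_sq hA hB hD] at hloss
    rw [← div_le_iff₀ hBD]
    refine le_trans (le_of_eq ?_) hloss
    field_simp; ring
  have hΔ' : 24 * M ^ 2 < (g - g') ^ 2 * D := by
    refine hΔ.trans_le ?_
    rw [hΔ_sq, div_mul_eq_mul_div, div_le_iff₀ (by positivity)]
    nlinarith [mul_nonneg (sq_nonneg (g - g')) (mul_nonneg hD.le hD.le)]
  rcases le_total B D with h | h
  · refine le_of_mul_le_mul_right ?_ hD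
    linarith [mul_le_mul_of_nonneg_left h (sq_nonneg M)]
  · refine absurd (le_of_mul_le_mul_right ?_ hB) hΔ'.not_ge
    linarith [mul_le_mul_of_nonneg_left h (sq_nonneg M)]

end Contrast

/-! ### CUSUM statistics under bounded noise -/

section Cusum

variable {T : ℕ} {f : ℕ → ℝ} {M : ℝ} {x : Obs T → ℝ}

/-- The sum of the observations in `(p, q]`. -/
noncomputable def blockSum (x : Obs T → ℝ) (p q : ℕ) : ℝ :=
  ∑ t : Obs T with p < t.1 ∧ t.1 ≤ q, x t

/-- The sum over `(p, q]` of the noise `x t - f t`. -/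
noncomputable def noiseSum (f : ℕ → ℝ) (x : Obs T → ℝ) (p q : ℕ) : ℝ :=
  blockSum (fun t => x t - f t.1) p q

/-- All normalised block sums of the noise are bounded by `M`; squaring avoids square roots. -/
def NoiseBounded (T : ℕ) (f : ℕ → ℝ) (M : ℝ) (x : Obs T → ℝ) : Prop :=
  ∀ p q : ℕ, p < q → q ≤ T → noiseSum f x p q ^ 2 ≤ M ^ 2 * ((q : ℝ) - p)

theorem blockSum_add (x y : Obs T → ℝ) (p q : ℕ) :
    blockSum (fun t => x t + y t) p q = blockSum x p q + blockSum y p q :=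
  Finset.sum_add_distrib

theorem blockSum_append (x : Obs T → ℝ) {p q r : ℕ} (hpq : p ≤ q) (hqr : q ≤ r) :
    blockSum x p q + blockSum x q r = blockSum x p r := by
  classical
  rw [blockSum, blockSum, blockSum, ← Finset.sum_union]
  · congr 1
    ext t
    simp only [Finset.mem_union, Finset.mem_filter, Finset.mem_univ, true_and]
    lia
  · rw [Finset.disjoint_left]
    intro t
    simp only [Finset.mem_filter, Finset.mem_univ, true_and]
    lia

theorem blockSum_coe (f : ℕ → ℝ) {p q : ℕ} (hq : q ≤ T) :
    blockSum (fun t : Obs T => f t.1) p q = ∑ t ∈ Finset.Ioc p q, f t := by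
  refine Finset.sum_bij (fun t _ => t.1) (fun t ht => by simpa using ht)
    (fun _ _ _ _ h => Subtype.ext h) (fun t ht => ?_) (fun _ _ => rfl)
  rw [Finset.mem_Ioc] at ht
  exact ⟨⟨t, Finset.mem_Icc.2 ⟨by lia, by lia⟩⟩, by simpa using ht, rfl⟩

theorem blockSum_eq_add_noiseSum (x : Obs T → ℝ) (f : ℕ → ℝ) (c : ℝ) {p q : ℕ} (hpq : p ≤ q)
    (hq : q ≤ T) :
    blockSum x p q =
      ((q : ℝ) - p) * c + (blockSum (fun t : Obs T => f t.1 - c) p q + noiseSum f x p q) := by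
  have hc : blockSum (fun _ : Obs T => c) p q = ((q : ℝ) - p) * c := by
    simpa [Nat.cast_sub hpq] using blockSum_coe (fun _ => c) (p := p) hq
  rw [← hc, noiseSum, ← blockSum_add, ← blockSum_add]
  congr 1; funext t; ring

theorem blockSum_eq_mul_add_noiseSum (x : Obs T → ℝ) {p q : ℕ} {g : ℝ} (hpq : p ≤ q)
    (hq : q ≤ T) (h : ∀ t ∈ Finset.Ioc p q, f t = g) :
    blockSum x p q = ((q : ℝ) - p) * g + noiseSum f x p q := by
  rw [blockSum_eq_add_noiseSum x f g hpq hq, blockSum_coe (fun t => f t - g) hq,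
    Finset.sum_eq_zero fun t ht => sub_eq_zero.2 (h t ht), zero_add]

theorem sq_blockSum_div_le (f : ℕ → ℝ) {p q : ℕ} (hpq : p < q) (hq : q ≤ T) :
    blockSum (fun t : Obs T => f t.1) p q ^ 2 / ((q : ℝ) - p) ≤
      ∑ t ∈ Finset.Ioc p q, f t ^ 2 := by
  rw [div_le_iff₀ (sub_pos.2 (Nat.cast_lt.2 hpq)), blockSum_coe f hq, mul_comm,
    ← Nat.cast_sub hpq.le, ← Nat.card_Ioc]
  exact sq_sum_le_card_mul_sum_sq

theorem cusum_eq_contrast (x : Obs T → ℝ) (l r s : ℕ) :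
    cusum x (l, r) s =
      contrast ((s : ℝ) - l) ((r : ℝ) - s) (blockSum x l s) (blockSum x s r) := by
  simp only [cusum, contrast, blockSum]
  rw [show (s : ℝ) - l + (r - s) = r - l by ring]

theorem abs_contrast_noiseSum_le (hM : 0 ≤ M) (hx : NoiseBounded T f M x) {l s r : ℕ}
    (hls : l < s) (hsr : s < r) (hr : r ≤ T) :
    |contrast ((s : ℝ) - l) ((r : ℝ) - s) (noiseSum f x l s) (noiseSum f x s r)| ≤ 3 / 2 * M :=
  abs_contrast_le (sub_pos.2 (Nat.cast_lt.2 hls)) (sub_pos.2 (Nat.cast_lt.2 hsr)) hM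
    (hx l s hls (hsr.le.trans hr)) (hx s r hsr hr)

theorem abs_cusum_le (hM : 0 ≤ M) (hx : NoiseBounded T f M x) {l s r : ℕ} (hls : l < s)
    (hsr : s < r) (hr : r ≤ T) (c : ℝ) :
    |cusum x (l, r) s| ≤ √(∑ t ∈ Finset.Ioc l r, (f t - c) ^ 2) + 3 / 2 * M := by
  have hA : (0 : ℝ) < s - l := sub_pos.2 (Nat.cast_lt.2 hls)
  have hR : (0 : ℝ) < r - s := sub_pos.2 (Nat.cast_lt.2 hsr)
  have hsT : s ≤ T := hsr.le.trans hr
  rw [cusum_eq_contrast, blockSum_eq_add_noiseSum x f c hls.le hsT,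
    blockSum_eq_add_noiseSum x f c hsr.le hr, contrast_add, contrast_mul_mul hA hR, sub_self,
    mul_zero, zero_add, contrast_add]
  refine (abs_add_le _ _).trans
    (add_le_add (Real.abs_le_sqrt ?_) (abs_contrast_noiseSum_le hM hx hls hsr hr))
  calc _ ≤ _ := contrast_sq_le hA hR _ _
    _ ≤ ∑ t ∈ Finset.Ioc l s, (f t - c) ^ 2 + ∑ t ∈ Finset.Ioc s r, (f t - c) ^ 2 :=
      add_le_add (sq_blockSum_div_le (fun t => f t - c) hls hsT)
        (sq_blockSum_div_le (fun t => f t - c) hsr hr)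
    _ = _ := Finset.sum_Ioc_consecutive _ hls.le hsr.le

theorem le_abs_cusum (hM : 0 ≤ M) (hx : NoiseBounded T f M x) {l s r : ℕ} (hls : l < s)
    (hsr : s < r) (hr : r ≤ T) {g g' : ℝ} (hg : ∀ t ∈ Finset.Ioc l s, f t = g)
    (hg' : ∀ t ∈ Finset.Ioc s r, f t = g') :
    √(((s : ℝ) - l) * (r - s) / (r - l)) * |g - g'| - 3 / 2 * M ≤ |cusum x (l, r) s| := by
  rw [cusum_eq_contrast, blockSum_eq_mul_add_noiseSum x hls.le (hsr.le.trans hr) hg,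
    blockSum_eq_mul_add_noiseSum x hsr.le hr hg', contrast_add,
    contrast_mul_mul (sub_pos.2 (Nat.cast_lt.2 hls)) (sub_pos.2 (Nat.cast_lt.2 hsr)),
    show (s : ℝ) - l + (r - s) = r - l by ring]
  have hjump := abs_mul √(((s : ℝ) - l) * (r - s) / (r - l)) (g - g')
  rw [abs_of_nonneg (Real.sqrt_nonneg _)] at hjump
  have hnoise := abs_contrast_noiseSum_le hM hx hls hsr hr
  have htri := norm_sub_le_norm_add (√(((s : ℝ) - l) * (r - s) / (r - l)) * (g - g'))
    (contrast ((s : ℝ) - l) (r - s) (noiseSum f x l s) (noiseSum f x s r))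
  simp only [Real.norm_eq_abs] at htri
  linarith

theorem jump_sq_mul_le_of_bestSplit_lt (hM : 0 ≤ M) (hx : NoiseBounded T f M x) {l s η r : ℕ}
    (hls : l < s) (hsη : s < η) (hηr : η < r) (hr : r ≤ T) {g g' : ℝ}
    (hg : ∀ t ∈ Finset.Ioc l η, f t = g) (hg' : ∀ t ∈ Finset.Ioc η r, f t = g')
    (hmax : |cusum x (l, r) η| ≤ |cusum x (l, r) s|) (hbig : 10 * M < |cusum x (l, r) s|) :
    (g - g') ^ 2 * ((η : ℝ) - s) ≤ 24 * M ^ 2 := by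
  have hbd := hx s r (hsη.trans hηr) hr
  rw [noiseSum, ← blockSum_append _ hsη.le hηr.le, ← sub_add_sub_cancel' (η : ℝ) s r] at hbd
  have hls_eq := blockSum_eq_mul_add_noiseSum x hls.le (by lia)
    fun t ht => hg t (Finset.Ioc_subset_Ioc_right hsη.le ht)
  have hsη_eq := blockSum_eq_mul_add_noiseSum x hsη.le (by lia)
    fun t ht => hg t (Finset.Ioc_subset_Ioc_left hls.le ht)
  have hηr_eq := blockSum_eq_mul_add_noiseSum x hηr.le hr hg'
  rw [cusum_eq_contrast x l r s, ← blockSum_append x hsη.le hηr.le,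
    ← sub_add_sub_cancel' (η : ℝ) s r, hls_eq, hsη_eq, hηr_eq] at hmax hbig
  rw [cusum_eq_contrast, ← blockSum_append x hls.le hsη.le, ← sub_add_sub_cancel' (s : ℝ) l η,
    hls_eq, hsη_eq, hηr_eq] at hmax
  exact jump_sq_mul_le_of_contrast_le (sub_pos.2 (Nat.cast_lt.2 hls))
    (sub_pos.2 (Nat.cast_lt.2 hsη)) (sub_pos.2 (Nat.cast_lt.2 hηr)) hM (hx l s hls (by lia))
    (hx s η hsη (by lia)) (hx η r hηr hr) hbd hmax hbig

theorem jump_sq_mul_le_of_lt_bestSplit (hM : 0 ≤ M) (hx : NoiseBounded T f M x) {l η s r : ℕ}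
    (hlη : l < η) (hηs : η < s) (hsr : s < r) (hr : r ≤ T) {g g' : ℝ}
    (hg : ∀ t ∈ Finset.Ioc l η, f t = g) (hg' : ∀ t ∈ Finset.Ioc η r, f t = g')
    (hmax : |cusum x (l, r) η| ≤ |cusum x (l, r) s|) (hbig : 10 * M < |cusum x (l, r) s|) :
    (g' - g) ^ 2 * ((s : ℝ) - η) ≤ 24 * M ^ 2 := by
  have hdb := hx l s (hlη.trans hηs) (by lia)
  rw [noiseSum, ← blockSum_append _ hlη.le hηs.le, add_comm,
    ← sub_add_sub_cancel (s : ℝ) η l] at hdb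
  have hlη_eq := blockSum_eq_mul_add_noiseSum x hlη.le (by lia) hg
  have hηs_eq := blockSum_eq_mul_add_noiseSum x hηs.le (by lia)
    fun t ht => hg' t (Finset.Ioc_subset_Ioc_right hsr.le ht)
  have hsr_eq := blockSum_eq_mul_add_noiseSum x hsr.le hr
    fun t ht => hg' t (Finset.Ioc_subset_Ioc_left hηs.le ht)
  rw [cusum_eq_contrast x l r s, contrast_swap, abs_neg, ← blockSum_append x hlη.le hηs.le,
    add_comm (blockSum x l η), ← sub_add_sub_cancel (s : ℝ) η l, hlη_eq, hηs_eq, hsr_eq]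
    at hmax hbig
  rw [cusum_eq_contrast, contrast_swap, abs_neg, ← blockSum_append x hηs.le hsr.le,
    add_comm (blockSum x η s), ← sub_add_sub_cancel (r : ℝ) s η, hlη_eq, hηs_eq, hsr_eq] at hmax
  exact jump_sq_mul_le_of_contrast_le (sub_pos.2 (Nat.cast_lt.2 hsr))
    (sub_pos.2 (Nat.cast_lt.2 hηs)) (sub_pos.2 (Nat.cast_lt.2 hlη)) hM (hx s r hsr hr)
    (hx η s hηs (by lia)) (hx l η hlη (by lia)) hdb hmax hbig

theorem jump_sq_mul_abs_sub_le (hM : 0 ≤ M) (hx : NoiseBounded T f M x) {l η r s : ℕ}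
    (hlη : l < η) (hηr : η < r) (hr : r ≤ T) {g g' : ℝ} (hg : ∀ t ∈ Finset.Ioc l η, f t = g)
    (hg' : ∀ t ∈ Finset.Ioc η r, f t = g') (hs : IsBestSplit x (l, r) s)
    (hbig : 10 * M < |cusum x (l, r) s|) : (g' - g) ^ 2 * |(s : ℝ) - η| ≤ 24 * M ^ 2 := by
  obtain ⟨hls, hsr⟩ : l < s ∧ s < r := Finset.mem_Ioo.1 hs.1
  have hmax := hs.2 η (Finset.mem_Ioo.2 ⟨hlη, hηr⟩)
  rcases lt_trichotomy s η with h | rfl | h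
  · rw [abs_of_neg (sub_neg.2 (Nat.cast_lt.2 h)), neg_sub, ← neg_sub g, neg_sq]
    exact jump_sq_mul_le_of_bestSplit_lt hM hx hls h hηr hr hg hg' hmax hbig
  · rw [sub_self, abs_zero, mul_zero]
    positivity
  · rw [abs_of_pos (sub_pos.2 (Nat.cast_lt.2 h))]
    exact jump_sq_mul_le_of_lt_bestSplit hM hx hlη h hsr hr hg hg' hmax hbig

end Cusum

/-! ### Changes localised by nearby points -/

section Localisation

variable {T : ℕ} {f : ℕ → ℝ} {M : ℝ} {x : Obs T → ℝ}

/-- The point `z` estimates the change `η` with the accuracy that is achieved at noise level `M`. -/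
def Localises (f : ℕ → ℝ) (M : ℝ) (z η : ℕ) : Prop :=
  (f (η + 1) - f η) ^ 2 * |(z : ℝ) - η| ≤ 24 * M ^ 2

/-- Every change is detectable at noise level `M`. The constant is `16 * 12 ^ 2`: an interval
reaching `minSpacing T f / 8` to both sides of a change has squared signal at least
`jump ^ 2 * minSpacing T f / 16`, which has to exceed the square of threshold plus noise. -/
def StrongChanges (T : ℕ) (f : ℕ → ℝ) (M : ℝ) : Prop :=
  ∀ η ∈ changePoints T f, 2304 * M ^ 2 ≤ (f (η + 1) - f η) ^ 2 * minSpacing T f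

theorem Localises.mono_left {z l η : ℕ} (h : Localises f M z η) (hzl : z ≤ l) (hlη : l ≤ η) :
    Localises f M l η := by
  have hz : (z : ℝ) ≤ l := Nat.cast_le.2 hzl
  have hl : (l : ℝ) ≤ η := Nat.cast_le.2 hlη
  refine le_trans (mul_le_mul_of_nonneg_left ?_ (sq_nonneg _)) h
  rw [abs_of_nonpos (by linarith), abs_of_nonpos (by linarith)]
  linarith

theorem Localises.mono_right {z r η : ℕ} (h : Localises f M z η) (hrz : r ≤ z) (hηr : η ≤ r) :
    Localises f M r η := by
  have hz : (r : ℝ) ≤ z := Nat.cast_le.2 hrz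
  have hr : (η : ℝ) ≤ r := Nat.cast_le.2 hηr
  refine le_trans (mul_le_mul_of_nonneg_left ?_ (sq_nonneg _)) h
  rw [abs_of_nonneg (by linarith), abs_of_nonneg (by linarith)]
  linarith

theorem Localises.abs_sub_le {z η : ℕ} (h : Localises f M z η) (hf : StrongChanges T f M)
    (hη : η ∈ changePoints T f) : 16 * |(z : ℝ) - η| ≤ minSpacing T f := by
  have hjump : 0 < (f (η + 1) - f η) ^ 2 :=
    sq_pos_of_ne_zero (sub_ne_zero.2 (mem_changePoints.1 hη).2)
  refine le_of_mul_le_mul_left ?_ hjump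
  have := hf η hη
  unfold Localises at h
  linarith [sq_nonneg M]

theorem Localises.le_add {z η : ℕ} (h : Localises f M z η) (hf : StrongChanges T f M)
    (hη : η ∈ changePoints T f) : 16 * z ≤ 16 * η + minSpacing T f := by
  have := h.abs_sub_le hf hη
  have : 16 * (z : ℝ) ≤ 16 * η + minSpacing T f := by linarith [le_abs_self ((z : ℝ) - η)]
  exact_mod_cast this

theorem Localises.add_le {z η : ℕ} (h : Localises f M z η) (hf : StrongChanges T f M)
    (hη : η ∈ changePoints T f) : 16 * η ≤ 16 * z + minSpacing T f := by
  have := h.abs_sub_le hf hη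
  have : 16 * (η : ℝ) ≤ 16 * z + minSpacing T f := by linarith [neg_abs_le ((z : ℝ) - η)]
  exact_mod_cast this

theorem eq_left_of_isolated {l η : ℕ} (hη : η ∈ changePoints T f)
    (h : η ≤ l + minSpacing T f) : ∀ t ∈ Finset.Ioc l η, f t = f η := by
  intro t ht
  obtain ⟨hlt, ht⟩ := Finset.mem_Ioc.1 ht
  have hηT := (mem_changePoints.1 hη).1
  refine (eq_of_no_changePoint (T := T) (by lia) ht (by lia) fun y hy hty => ?_).symm
  by_contra! hyη
  have := add_minSpacing_le hy hη hyη
  lia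

theorem eq_right_of_isolated {r η : ℕ} (hη : η ∈ changePoints T f) (hr : r ≤ T)
    (h : r ≤ η + minSpacing T f) : ∀ t ∈ Finset.Ioc η r, f t = f (η + 1) := by
  intro t ht
  obtain ⟨hηt, ht⟩ := Finset.mem_Ioc.1 ht
  refine eq_of_no_changePoint (T := T) (by lia) hηt (by lia) fun y hy hηy => ?_
  have := add_minSpacing_le hη hy hηy
  lia

theorem sum_Ioc_sub_sq {p q : ℕ} {g : ℝ} (hpq : p ≤ q) (h : ∀ t ∈ Finset.Ioc p q, f t = g)
    (c : ℝ) : ∑ t ∈ Finset.Ioc p q, (f t - c) ^ 2 = ((q : ℝ) - p) * (g - c) ^ 2 := by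
  rw [Finset.sum_congr rfl fun t ht => by rw [h t ht], Finset.sum_const, Nat.card_Ioc,
    nsmul_eq_mul, Nat.cast_sub hpq]

theorem exists_left_cut {l r : ℕ} (hf : StrongChanges T f M) (hlr : l < r) :
    ∃ p, l ≤ p ∧ p < r ∧ ∑ t ∈ Finset.Ioc l p, (f t - f (p + 1)) ^ 2 ≤ 24 * M ^ 2 ∧
      ∀ y ∈ changePoints T f, l < y → y < r → Localises f M l y → y ≤ p := by
  by_cases hex : ∃ η ∈ changePoints T f, l < η ∧ η < r ∧ Localises f M l η
  · obtain ⟨η, hη, hlη, hηr, hloc⟩ := hex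
    have hclose := hloc.add_le hf hη
    refine ⟨η, hlη.le, hηr, ?_, fun y hy _ _ hlocy => ?_⟩
    · rw [sum_Ioc_sub_sq hlη.le (eq_left_of_isolated hη (by lia)), mul_comm, ← neg_sub, neg_sq,
        ← abs_of_pos (sub_pos.2 (Nat.cast_lt.2 hlη)), abs_sub_comm]
      exact hloc
    · by_contra! hηy
      have := hlocy.add_le hf hy
      have := add_minSpacing_le hη hy hηy
      lia
  · refine ⟨l, le_rfl, hlr, ?_, fun y hy hly hyr hloc => absurd ⟨y, hy, hly, hyr, hloc⟩ hex⟩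
    rw [Finset.Ioc_self, Finset.sum_empty]
    positivity

theorem exists_right_cut {p r : ℕ} (hf : StrongChanges T f M) (hpr : p < r) (hr : r ≤ T) :
    ∃ q, p < q ∧ q ≤ r ∧ ∑ t ∈ Finset.Ioc q r, (f t - f q) ^ 2 ≤ 24 * M ^ 2 ∧
      ∀ y ∈ changePoints T f, p < y → y < r → Localises f M r y → q ≤ y := by
  by_cases hex : ∃ η ∈ changePoints T f, p < η ∧ η < r ∧ Localises f M r η
  · obtain ⟨η, hη, hpη, hηr, hloc⟩ := hex
    have hclose := hloc.le_add hf hη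
    refine ⟨η, hpη, hηr.le, ?_, fun y hy _ _ hlocy => ?_⟩
    · rw [sum_Ioc_sub_sq hηr.le (eq_right_of_isolated hη hr (by lia)), mul_comm,
        ← abs_of_pos (sub_pos.2 (Nat.cast_lt.2 hηr))]
      exact hloc
    · by_contra! hyη
      have := hlocy.le_add hf hy
      have := add_minSpacing_le hy hη hyη
      lia
  · refine ⟨r, hpr, le_rfl, ?_, fun y hy hpy hyr hloc => absurd ⟨y, hy, hpy, hyr, hloc⟩ hex⟩
    rw [Finset.Ioc_self, Finset.sum_empty]
    positivity

/-- Up to the changes next to its two ends the signal is constant on the interval, so it is within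
squared distance `2 * 24 * M ^ 2` of a constant. -/
theorem abs_cusum_le_of_forall_localises {l r s : ℕ} (hM : 0 ≤ M) (hx : NoiseBounded T f M x)
    (hf : StrongChanges T f M) (hls : l < s) (hsr : s < r) (hr : r ≤ T)
    (hnear : ∀ η ∈ changePoints T f, l < η → η < r → Localises f M l η ∨ Localises f M r η) :
    |cusum x (l, r) s| ≤ 10 * M := by
  obtain ⟨p, hlp, hpr, hsum_left, hp⟩ := exists_left_cut hf (hls.trans hsr)
  obtain ⟨q, hpq, hqr, hsum_right, hq⟩ := exists_right_cut hf hpr hr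
  have hmid : ∀ t ∈ Finset.Ioc p q, f t = f (p + 1) := by
    intro t ht
    obtain ⟨hpt, htq⟩ := Finset.mem_Ioc.1 ht
    refine eq_of_no_changePoint (T := T) (by lia) hpt (by lia) fun y hy hpy => ?_
    by_contra! hyt
    rcases hnear y hy (by lia) (by lia) with h | h
    · have := hp y hy (by lia) (by lia) h
      lia
    · have := hq y hy (by lia) (by lia) h
      lia
  have hsum : ∑ t ∈ Finset.Ioc l r, (f t - f (p + 1)) ^ 2 ≤ 48 * M ^ 2 := by
    rw [← Finset.sum_Ioc_consecutive _ hlp hpr.le, ← Finset.sum_Ioc_consecutive _ hpq.le hqr,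
      sum_Ioc_sub_sq hpq.le hmid, ← hmid q (Finset.mem_Ioc.2 ⟨hpq, le_rfl⟩), sub_self]
    rw [← hmid q (Finset.mem_Ioc.2 ⟨hpq, le_rfl⟩)] at hsum_left
    linarith
  have hdist : √(∑ t ∈ Finset.Ioc l r, (f t - f (p + 1)) ^ 2) ≤ 7 * M :=
    Real.sqrt_le_iff.2 ⟨by positivity, by linarith [sq_nonneg M]⟩
  linarith [abs_cusum_le hM hx hls hsr hr (f (p + 1))]

theorem exists_changePoint_of_lt_abs_cusum {l r s : ℕ} (hM : 0 ≤ M) (hx : NoiseBounded T f M x)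
    (hf : StrongChanges T f M) (hls : l < s) (hsr : s < r) (hr : r ≤ T)
    (hbig : 10 * M < |cusum x (l, r) s|) :
    ∃ η ∈ changePoints T f, (l < η ∧ η < r) ∧ ∀ z, Localises f M z η → l < z ∧ z ≤ r := by
  by_contra! hcon
  refine hbig.not_ge (abs_cusum_le_of_forall_localises hM hx hf hls hsr hr fun η hη hlη hηr => ?_)
  obtain ⟨z, hz, hzlr⟩ := hcon η hη ⟨hlη, hηr⟩
  rcases le_or_gt z l with hzl | hlz
  · exact .inl (hz.mono_left hzl hlη.le)
  · exact .inr (hz.mono_right (hzlr hlz).le hηr.le)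

theorem localises_of_isBestSplit {l r η s : ℕ} (hM : 0 ≤ M) (hx : NoiseBounded T f M x)
    (hη : η ∈ changePoints T f) (hlη : l < η) (hηr : η < r) (hr : r ≤ T)
    (hlen : r ≤ l + minSpacing T f + 1) (hs : IsBestSplit x (l, r) s)
    (hbig : 10 * M < |cusum x (l, r) s|) : Localises f M s η :=
  jump_sq_mul_abs_sub_le hM hx hlη hηr hr (eq_left_of_isolated hη (by lia))
    (eq_right_of_isolated hη hr (by lia)) hs hbig

theorem exists_isBestSplit (x : Obs T → ℝ) {l η r : ℕ} (hlη : l < η) (hηr : η < r) :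
    ∃ s, IsBestSplit x (l, r) s ∧ |cusum x (l, r) η| ≤ |cusum x (l, r) s| := by
  have hη : η ∈ Finset.Ioo l r := Finset.mem_Ioo.2 ⟨hlη, hηr⟩
  obtain ⟨s, hs, hmax⟩ :=
    Finset.exists_max_image (Finset.Ioo l r) (fun s => |cusum x (l, r) s|) ⟨η, hη⟩
  exact ⟨s, ⟨hs, hmax⟩, hmax η hη⟩

theorem overThreshold_of_balanced {l r η : ℕ} (hM : 0 < M) (hx : NoiseBounded T f M x)
    (hf : StrongChanges T f M) (hη : η ∈ changePoints T f) (hlη : l < η) (hηr : η < r) (hr : r ≤ T)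
    (hl : η ≤ l + minSpacing T f) (hr' : r ≤ η + minSpacing T f)
    (hbal_left : minSpacing T f ≤ 8 * (η - l)) (hbal_right : minSpacing T f ≤ 8 * (r - η)) :
    OverThreshold (10 * M) x (l, r) := by
  obtain ⟨s, hs, hηs⟩ := exists_isBestSplit x hlη hηr
  refine ⟨s, hs, lt_of_lt_of_le ?_ hηs⟩
  have hA : (0 : ℝ) < η - l := sub_pos.2 (Nat.cast_lt.2 hlη)
  have hR : (0 : ℝ) < r - η := sub_pos.2 (Nat.cast_lt.2 hηr)
  have hA₈ : (minSpacing T f : ℝ) ≤ 8 * (η - l) := by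
    rw [← Nat.cast_sub hlη.le]; exact_mod_cast hbal_left
  have hR₈ : (minSpacing T f : ℝ) ≤ 8 * (r - η) := by
    rw [← Nat.cast_sub hηr.le]; exact_mod_cast hbal_right
  have hweight : (minSpacing T f : ℝ) / 16 ≤ ((η : ℝ) - l) * (r - η) / (r - l) := by
    rw [le_div_iff₀ (by linarith)]
    nlinarith
  have hsignal : 12 * M ≤ √(((η : ℝ) - l) * (r - η) / (r - l)) * |f η - f (η + 1)| := by
    rw [← Real.sqrt_sq_eq_abs, ← Real.sqrt_mul (le_trans (by positivity) hweight),
      ← neg_sub (f (η + 1)), neg_sq]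
    refine Real.le_sqrt_of_sq_le ?_
    linarith [mul_le_mul_of_nonneg_right hweight (sq_nonneg (f (η + 1) - f η)), hf η hη]
  linarith [le_abs_cusum hM.le hx hlη hηr hr (eq_left_of_isolated hη hl)
    (eq_right_of_isolated hη hr hr')]

end Localisation

/-! ### Seeded intervals -/

section Seeded

variable {a : ℝ} {T k m : ℕ}

theorem one_le_layerCount (ha : 0 < a) : 1 ≤ layerCount a k := by
  have : 0 < ⌈(1 / a) ^ (k - 1)⌉₊ := Nat.ceil_pos.2 (by positivity)
  rw [layerCount]; lia

theorem layerCount_sub_one (ha : 0 < a) :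
    (layerCount a k : ℝ) - 1 = 2 * ((⌈(1 / a) ^ (k - 1)⌉₊ : ℝ) - 1) := by
  have h : 0 < ⌈(1 / a) ^ (k - 1)⌉₊ := Nat.ceil_pos.2 (by positivity)
  have : layerCount a k + 1 = 2 * ⌈(1 / a) ^ (k - 1)⌉₊ := by rw [layerCount]; lia
  have : (layerCount a k : ℝ) + 1 = 2 * ⌈(1 / a) ^ (k - 1)⌉₊ := by exact_mod_cast this
  linarith

theorem layerLength_mul_inv_pow (ha : 0 < a) :
    layerLength a T k * (1 / a) ^ (k - 1) = T := by
  rw [layerLength, mul_assoc, ← mul_pow, mul_one_div_cancel ha.ne', one_pow, mul_one]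

theorem one_lt_inv_pow (ha : 0 < a) (ha1 : a < 1) (hk : 2 ≤ k) :
    1 < (1 / a) ^ (k - 1) :=
  one_lt_pow₀ ((one_lt_div ha).2 ha1) (by lia)

theorem layerCount_sub_one_pos (ha : 0 < a) (ha1 : a < 1) (hk : 2 ≤ k) :
    (0 : ℝ) < (layerCount a k : ℝ) - 1 := by
  rw [layerCount_sub_one ha]
  have := (one_lt_inv_pow ha ha1 hk).trans_le (Nat.le_ceil _)
  linarith

theorem layerShift_nonneg (ha : 0 < a) (ha1 : a < 1) (hk : 2 ≤ k) :
    0 ≤ layerShift a T k := by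
  refine div_nonneg ?_ (layerCount_sub_one_pos ha ha1 hk).le
  rw [layerLength, sub_nonneg]
  exact mul_le_of_le_one_right (Nat.cast_nonneg _) (pow_le_one₀ ha.le ha1.le)

theorem layerShift_le (ha : 0 < a) (ha1 : a < 1) (hk : 2 ≤ k) :
    layerShift a T k ≤ layerLength a T k / 2 := by
  rw [layerShift, div_le_iff₀ (layerCount_sub_one_pos ha ha1 hk), layerCount_sub_one ha]
  have hL : 0 ≤ layerLength a T k := by rw [layerLength]; positivity
  have hT := layerLength_mul_inv_pow (T := T) (k := k) ha
  linarith [mul_le_mul_of_nonneg_left (Nat.le_ceil ((1 / a) ^ (k - 1))) hL]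

theorem layer_right_end (ha : 0 < a) (ha1 : a < 1) (hk : 2 ≤ k) :
    ((layerCount a k : ℝ) - 1) * layerShift a T k + layerLength a T k = T := by
  rw [layerShift, mul_div_cancel₀ _ (layerCount_sub_one_pos ha ha1 hk).ne']
  ring

theorem right_le_of_mem_seededIntervals (ha : 0 < a) (ha1 : a < 1) {I : ℕ × ℕ}
    (hI : I ∈ seededIntervals a T) : I.2 ≤ T := by
  simp only [seededIntervals, layer, Finset.mem_biUnion, Finset.mem_image, Finset.mem_Icc] at hI
  obtain ⟨k, ⟨hk, -⟩, i, ⟨hi1, hi2⟩, rfl⟩ := hI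
  refine Nat.ceil_le.2 ?_
  rcases hk.eq_or_lt with rfl | hk
  · have : i = 1 := by
      simp only [layerCount, Nat.sub_self, pow_zero, Nat.ceil_one] at hi2
      lia
    subst this
    simp [layerLength]
  · rw [← layer_right_end (T := T) ha ha1 hk]
    have hi : (i : ℝ) ≤ layerCount a k := by exact_mod_cast hi2
    have := mul_le_mul_of_nonneg_right (sub_le_sub_right hi 1)
      (layerShift_nonneg (T := T) ha ha1 hk)
    linarith

theorem exists_layer {d : ℕ} (ha : 1 / 2 ≤ a) (ha1 : a < 1) (hd : 2 ≤ d) (hdT : d < T) :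
    ∃ k, 2 ≤ k ∧ k ≤ ⌈Real.logb (1 / a) T⌉₊ ∧ a * d < layerLength a T k ∧
      layerLength a T k ≤ d := by
  have ha0 : 0 < a := by linarith
  have hT : (0 : ℝ) < T := by exact_mod_cast (by lia : 0 < T)
  have hd' : (2 : ℝ) ≤ d := by exact_mod_cast hd
  have hex : ∃ j : ℕ, (T : ℝ) * a ^ j ≤ d := by
    obtain ⟨j, hj⟩ := exists_pow_lt_of_lt_one (x := (d : ℝ) / T) (by positivity) ha1
    rw [lt_div_iff₀ hT] at hj
    exact ⟨j, by linarith⟩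
  obtain ⟨j, hj, hmin⟩ : ∃ j : ℕ, (T : ℝ) * a ^ j ≤ d ∧ ∀ i < j, ¬ (T : ℝ) * a ^ i ≤ d :=
    ⟨Nat.find hex, Nat.find_spec hex, fun i hi => Nat.find_min hex hi⟩
  have hj0 : j ≠ 0 := by
    rintro rfl
    simp only [pow_zero, mul_one] at hj
    have : T ≤ d := by exact_mod_cast hj
    lia
  have hlow : a * d < T * a ^ j := by
    have hprev := not_le.1 (hmin (j - 1) (by lia))
    rw [← pow_sub_one_mul hj0]
    linarith [mul_lt_mul_of_pos_left hprev ha0]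
  refine ⟨j + 1, by lia, ?_, by simpa [layerLength] using hlow, by simpa [layerLength] using hj⟩
  refine Nat.lt_ceil.2 ?_
  rw [Real.lt_logb_iff_rpow_lt ((one_lt_div ha0).2 ha1) hT, Real.rpow_natCast, one_div, inv_pow,
    inv_lt_iff_one_lt_mul₀ (by positivity), mul_comm]
  nlinarith

theorem exists_mem_layer (ha : 0 < a) (ha1 : a < 1) (hk : 2 ≤ k) {A : ℝ}
    (hA : layerLength a T k / 2 ≤ A) (hAT : A < T) :
    ∃ e : ℝ, A < e ∧ e ≤ A + layerLength a T k / 2 ∧ layerLength a T k ≤ e ∧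
      (⌊e - layerLength a T k⌋₊, ⌈e⌉₊) ∈ layer a T k := by
  have hex : ∃ j : ℕ, A < j * layerShift a T k + layerLength a T k := by
    refine ⟨layerCount a k - 1, ?_⟩
    rw [Nat.cast_sub (one_le_layerCount ha), Nat.cast_one, layer_right_end ha ha1 hk]
    exact hAT
  obtain ⟨j, hj, hmin⟩ : ∃ j : ℕ, A < j * layerShift a T k + layerLength a T k ∧
      ∀ i < j, ¬ A < i * layerShift a T k + layerLength a T k :=
    ⟨Nat.find hex, Nat.find_spec hex, fun i hi => Nat.find_min hex hi⟩
  have hs0 := layerShift_nonneg (T := T) ha ha1 hk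
  have hs := layerShift_le (T := T) ha ha1 hk
  refine ⟨j * layerShift a T k + layerLength a T k, hj, ?_, ?_, ?_⟩
  · rcases Nat.eq_zero_or_pos j with rfl | hj0
    · simp only [Nat.cast_zero, zero_mul, zero_add]; linarith
    · have hprev := not_lt.1 (hmin (j - 1) (by lia))
      rw [Nat.cast_sub hj0, Nat.cast_one] at hprev
      linarith
  · have : 0 ≤ (j : ℝ) * layerShift a T k := by positivity
    linarith
  · rw [layer, Finset.mem_image]
    refine ⟨j + 1, Finset.mem_Icc.2 ⟨by lia, ?_⟩, ?_⟩
    · have := one_le_layerCount (k := k) ha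
      by_contra hlt
      refine hmin (layerCount a k - 1) (by lia) ?_
      rw [Nat.cast_sub (one_le_layerCount ha), Nat.cast_one, layer_right_end ha ha1 hk]
      exact hAT
    · simp

/-- The offset `θ` trades space to the left of `η` for space to the right of `η`. -/
theorem exists_seeded_offset {d η : ℕ} {θ : ℝ} (ha : 1 / 2 ≤ a) (ha1 : a < 1) (hd : 2 ≤ d)
    (hdη : d ≤ η) (hηT : η + d ≤ T) (hm : (m : ℝ) ≤ a * d + 1) (hθ0 : 0 ≤ θ) (hθ : θ ≤ 1 / 2) :
    ∃ l r : ℕ, (l, r) ∈ seededIntervals a T ∧ m ≤ r - l ∧ r ≤ l + d + 1 ∧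
      l + (1 / 2 - θ) * (d / 2) ≤ η ∧ η < l + (1 - θ) * d + 1 ∧
      η + θ * (d / 2) < r ∧ r < η + (1 / 2 + θ) * d + 1 := by
  have ha0 : 0 < a := by linarith
  obtain ⟨k, hk2, hkK, hlow, hup⟩ := exists_layer ha ha1 hd (show d < T by lia)
  set L := layerLength a T k
  have hd' : (2 : ℝ) ≤ d := Nat.ofNat_le_cast.2 hd
  have hdη' : (d : ℝ) ≤ η := Nat.cast_le.2 hdη
  have hηT' : (η : ℝ) + d ≤ T := by exact_mod_cast hηT
  have hdL : (d : ℝ) / 2 < L := by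
    linarith [mul_le_mul_of_nonneg_right ha (Nat.cast_nonneg (α := ℝ) d)]
  have hθL0 : 0 ≤ θ * L := mul_nonneg hθ0 (by linarith)
  have hθL : θ * L ≤ 1 / 2 * L := by gcongr; linarith
  obtain ⟨e, he1, he2, he3, hmem⟩ := exists_mem_layer (T := T) ha0 ha1 hk2 (A := η + θ * L)
    (by linarith) (by linarith)
  have hr1 := Nat.le_ceil e
  have hr2 := Nat.ceil_lt_add_one (show 0 ≤ e by linarith)
  have hl1 := Nat.floor_le (sub_nonneg.2 he3)
  have hl2 := Nat.lt_floor_add_one (e - L)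
  refine ⟨⌊e - L⌋₊, ⌈e⌉₊, Finset.mem_biUnion.2 ⟨k, Finset.mem_Icc.2 ⟨by lia, hkK⟩, hmem⟩, ?_, ?_,
    ?_, ?_, ?_, ?_⟩
  · have : (m : ℝ) + ⌊e - L⌋₊ < ⌈e⌉₊ + 1 := by linarith
    have : m + ⌊e - L⌋₊ < ⌈e⌉₊ + 1 := by exact_mod_cast this
    lia
  · have : (⌈e⌉₊ : ℝ) < ⌊e - L⌋₊ + d + 2 := by linarith
    have : ⌈e⌉₊ < ⌊e - L⌋₊ + d + 2 := by exact_mod_cast this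
    lia
  · linarith [mul_le_mul_of_nonneg_left hdL.le (sub_nonneg.2 hθ)]
  · linarith [mul_le_mul_of_nonneg_left hup (show 0 ≤ 1 - θ by linarith)]
  · linarith [mul_le_mul_of_nonneg_left hdL.le hθ0]
  · linarith [mul_le_mul_of_nonneg_left hup (show 0 ≤ 1 / 2 + θ by linarith)]

/-- The room `d / 16` keeps the interval away from estimates of changes at `η - d` and `η + d`. The
offset `1 / 4` provides it for `4 ≤ d`; for `d ≤ 3` rounding forces the offset `0`. -/
theorem exists_seeded_around {d η : ℕ} (ha : 1 / 2 ≤ a) (ha1 : a < 1) (hd : 2 ≤ d)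
    (hdη : d ≤ η) (hηT : η + d ≤ T) (hm : (m : ℝ) ≤ a * d + 1) :
    ∃ l r : ℕ, (l, r) ∈ seededIntervals a T ∧ m ≤ r - l ∧ r ≤ l + d + 1 ∧ l < η ∧ η < r ∧
      d ≤ 8 * (η - l) ∧ d ≤ 8 * (r - η) ∧ η + d / 16 ≤ l + d ∧ r + d / 16 < η + d := by
  rcases le_or_gt d 3 with hd3 | hd4
  · obtain ⟨l, r, hmem, hmin, hlen, hl1, hl2, hr1, hr2⟩ :=
      exists_seeded_offset ha ha1 hd hdη hηT hm le_rfl (by norm_num)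
    have hbal_left : 4 * l + d ≤ 4 * η := by
      have : 4 * (l : ℝ) + d ≤ 4 * η := by linarith
      exact_mod_cast this
    have hlen_left : η < l + d + 1 := by
      have : (η : ℝ) < l + d + 1 := by linarith
      exact_mod_cast this
    have hbal_right : η < r := by
      have : (η : ℝ) < r := by linarith
      exact_mod_cast this
    have hlen_right : 2 * r < 2 * η + d + 2 := by
      have : 2 * (r : ℝ) < 2 * η + d + 2 := by linarith
      exact_mod_cast this
    exact ⟨l, r, hmem, hmin, hlen, by lia, by lia, by lia, by lia, by lia, by lia⟩
  · obtain ⟨l, r, hmem, hmin, hlen, hl1, hl2, hr1, hr2⟩ :=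
      exists_seeded_offset (θ := 1 / 4) ha ha1 hd hdη hηT hm (by norm_num) (by norm_num)
    have hbal_left : 8 * l + d ≤ 8 * η := by
      have : 8 * (l : ℝ) + d ≤ 8 * η := by linarith
      exact_mod_cast this
    have hlen_left : 4 * η < 4 * l + 3 * d + 4 := by
      have : 4 * (η : ℝ) < 4 * l + 3 * d + 4 := by linarith
      exact_mod_cast this
    have hbal_right : 8 * η + d < 8 * r := by
      have : 8 * (η : ℝ) + d < 8 * r := by linarith
      exact_mod_cast this
    have hlen_right : 4 * r < 4 * η + 3 * d + 4 := by
      have : 4 * (r : ℝ) < 4 * η + 3 * d + 4 := by linarith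
      exact_mod_cast this
    exact ⟨l, r, hmem, hmin, hlen, by lia, by lia, by lia, by lia, by lia, by lia⟩

theorem exists_overThreshold_around {η : ℕ} {f : ℕ → ℝ} {M : ℝ} {x : Obs T → ℝ}
    (ha : 1 / 2 ≤ a) (ha1 : a < 1) (hM : 0 < M) (hx : NoiseBounded T f M x)
    (hf : StrongChanges T f M) (hspacing : 2 ≤ minSpacing T f)
    (hm : (m : ℝ) ≤ a * minSpacing T f + 1) (hη : η ∈ changePoints T f) :
    ∃ J ∈ seededIntervals a T, m ≤ J.2 - J.1 ∧ OverThreshold (10 * M) x J ∧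
      J.2 - J.1 ≤ minSpacing T f + 1 ∧
      ∀ y ∈ changePoints T f, y ≠ η → ∀ z, Localises f M z y → ¬ (J.1 < z ∧ z ≤ J.2) := by
  have hηT := changePoint_add_minSpacing_le hη
  obtain ⟨l, r, hmem, hmin, hlen, hlη, hηr, hbal_left, hbal_right, hl, hr⟩ :=
    exists_seeded_around ha ha1 hspacing (minSpacing_le_changePoint hη) hηT hm
  have hover := overThreshold_of_balanced hM hx hf hη hlη hηr (by lia) (by lia) (by lia)
    hbal_left hbal_right
  refine ⟨(l, r), hmem, hmin, hover, by lia, fun y hy hyη z hz => ?_⟩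
  have hzy := hz.le_add hf hy
  have hyz := hz.add_le hf hy
  rcases hyη.lt_or_gt with hlt | hlt
  · have := add_minSpacing_le hy hη hlt
    lia
  · have := add_minSpacing_le hη hy hlt
    lia

end Seeded

/-! ### Narrowest-over-threshold selection -/

/-- Every element of `C` keeps an interval avoiding the estimates of the others, so it is never
discarded before it is estimated, and by narrowness the selected interval has length at most `L`;
a selected interval never serves an element twice, since it would contain the first estimate. -/
theorem NarrowestRun.exists_eq_image {T L : ℕ} {x : Obs T → ℝ} {A : Finset (ℕ × ℕ)} {S : Finset ℕ}
    (hrun : NarrowestRun x A S) {R : ℕ → ℕ → Prop} :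
    ∀ {C : Finset ℕ},
      (∀ η ∈ C, ∃ J ∈ A, J.2 - J.1 ≤ L ∧
        ∀ y ∈ C, y ≠ η → ∀ z, R z y → ¬ (J.1 < z ∧ z ≤ J.2)) →
      (∀ I ∈ A, ∃ η ∈ C, (∀ z, R z η → I.1 < z ∧ z ≤ I.2) ∧
        (I.2 - I.1 ≤ L → ∀ s, IsBestSplit x I s → R s η)) →
      ∃ σ : ℕ → ℕ, S = C.image σ ∧ ∀ η ∈ C, R (σ η) η := by
  induction hrun with
  | done =>
    intro C hsep _
    have hC : C = ∅ := Finset.eq_empty_iff_forall_notMem.2 fun η hη => by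
      obtain ⟨J, hJ, -⟩ := hsep η hη
      exact Finset.notMem_empty J hJ
    subst hC
    exact ⟨id, by simp⟩
  | step A I s S hI hmin hs _ ih =>
    intro C hsep hcover
    obtain ⟨η, hη, -, hbest⟩ := hcover I hI
    obtain ⟨J, hJ, hJL, -⟩ := hsep η hη
    have hsη : R s η := hbest ((hmin J hJ).trans hJL) s hs
    have hsep' : ∀ y ∈ C.erase η, ∃ K ∈ A.filter fun K => ¬ (K.1 < s ∧ s ≤ K.2),
        K.2 - K.1 ≤ L ∧ ∀ y' ∈ C.erase η, y' ≠ y → ∀ z, R z y' → ¬ (K.1 < z ∧ z ≤ K.2) := by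
      intro y hy
      obtain ⟨hyη, hyC⟩ := Finset.mem_erase.1 hy
      obtain ⟨K, hK, hKL, hKsep⟩ := hsep y hyC
      exact ⟨K, Finset.mem_filter.2 ⟨hK, hKsep η hη hyη.symm s hsη⟩, hKL,
        fun y' hy' => hKsep y' (Finset.mem_of_mem_erase hy')⟩
    obtain ⟨σ, rfl, hσ⟩ := ih hsep' fun K hK => by
      obtain ⟨hKA, hKs⟩ := Finset.mem_filter.1 hK
      obtain ⟨y, hy, hyK, hybest⟩ := hcover K hKA
      refine ⟨y, Finset.mem_erase.2 ⟨?_, hy⟩, hyK, hybest⟩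
      rintro rfl
      exact hKs (hyK s hsη)
    have hne : ∀ y ∈ C.erase η, Function.update σ η s y = σ y := fun y hy =>
      Function.update_of_ne (Finset.ne_of_mem_erase hy) _ _
    refine ⟨Function.update σ η s, ?_, ?_⟩
    · rw [← Finset.insert_erase hη, Finset.image_insert, Function.update_self,
        Finset.erase_insert (Finset.notMem_erase η C), Finset.image_congr hne]
    · rw [← Finset.insert_erase hη, Finset.forall_mem_insert, Function.update_self]
      exact ⟨hsη, fun y hy => by rw [hne y hy]; exact hσ y hy⟩

theorem accurate_of_noiseBounded {a : ℝ} {T m : ℕ} {f : ℕ → ℝ} {M : ℝ} {x : Obs T → ℝ}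
    (ha : 1 / 2 ≤ a) (ha1 : a < 1) (hM : 0 < M) (hx : NoiseBounded T f M x)
    (hf : StrongChanges T f M) (hspacing : 2 ≤ minSpacing T f)
    (hm : (m : ℝ) ≤ a * minSpacing T f + 1) {S : Finset ℕ} (hS : IsOutput a m (10 * M) x S) :
    Accurate T f S (24 * M ^ 2) := by
  classical
  obtain ⟨σ, rfl, hσ⟩ := NarrowestRun.exists_eq_image (R := Localises f M)
    (L := minSpacing T f + 1) (C := changePoints T f) hS
    (fun η hη => by
      obtain ⟨J, hJ, hJm, hJover, hJ'⟩ :=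
        exists_overThreshold_around ha ha1 hM hx hf hspacing hm hη
      exact ⟨J, Finset.mem_filter.2 ⟨hJ, hJm, hJover⟩, hJ'⟩)
    (fun I hI => by
      obtain ⟨hI, -, s, hs, hbig⟩ := Finset.mem_filter.1 hI
      have hIT := right_le_of_mem_seededIntervals (by linarith) ha1 hI
      obtain ⟨hls, hsr⟩ := Finset.mem_Ioo.1 hs.1
      obtain ⟨η, hη, ⟨hlη, hηr⟩, hz⟩ :=
        exists_changePoint_of_lt_abs_cusum hM.le hx hf hls hsr hIT hbig
      exact ⟨η, hη, hz, fun hlen s' hs' => localises_of_isBestSplit hM.le hx hη hlη hηr hIT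
        (by lia) hs' (hbig.trans_le (hs'.2 s hs.1))⟩)
  refine accurate_image (fun η hη => ?_) hσ
  have := (hσ η hη).abs_sub_le hf hη
  have : (2 : ℝ) ≤ minSpacing T f := Nat.ofNat_le_cast.2 hspacing
  linarith

open MeasureTheory ProbabilityTheory

/-! ### The noise event -/

theorem hasSubgaussianMGF_id_gaussianReal (v : NNReal) :
    HasSubgaussianMGF id v (gaussianReal 0 v) where
  integrable_exp_mul t := integrable_exp_mul_gaussianReal t
  mgf_le t := by simp [mgf_id_gaussianReal]

theorem measureReal_abs_ge_le_two_mul_exp {Ω : Type*} {mΩ : MeasurableSpace Ω} {μ : Measure Ω}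
    [IsFiniteMeasure μ] {X : Ω → ℝ} {c : NNReal} (h : HasSubgaussianMGF X c μ) {ε : ℝ}
    (hε : 0 ≤ ε) : μ.real {ω | ε ≤ |X ω|} ≤ 2 * Real.exp (-ε ^ 2 / (2 * c)) := by
  have hsub : {ω | ε ≤ |X ω|} ⊆ {ω | ε ≤ X ω} ∪ {ω | ε ≤ (-X) ω} :=
    fun ω (hω : ε ≤ |X ω|) => le_abs.1 hω
  calc μ.real {ω | ε ≤ |X ω|} ≤ μ.real {ω | ε ≤ X ω} + μ.real {ω | ε ≤ (-X) ω} :=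
        (measureReal_mono hsub).trans (measureReal_union_le _ _)
    _ ≤ 2 * Real.exp (-ε ^ 2 / (2 * c)) := by
        linarith [h.measure_ge_le hε, h.neg.measure_ge_le hε]

section Noise

variable {T : ℕ} (f : ℕ → ℝ)

instance isProbabilityMeasure_law : IsProbabilityMeasure (law T f) := by
  unfold law; infer_instance

theorem law_map_sub (t : Obs T) :
    (law T f).map (fun x => x t - f t.1) = gaussianReal 0 1 := by
  have heval : MeasurePreserving (Function.eval t) (law T f) (gaussianReal (f t.1) 1) :=
    measurePreserving_eval (fun t : Obs T => gaussianReal (f t.1) 1) t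
  have hcomp : (fun x : Obs T → ℝ => x t - f t.1) = (fun y => y - f t.1) ∘ Function.eval t := rfl
  rw [hcomp, ← Measure.map_map (by fun_prop) heval.measurable, heval.map_eq,
    gaussianReal_map_sub_const, sub_self]

theorem hasSubgaussianMGF_noise (t : Obs T) :
    HasSubgaussianMGF (fun x : Obs T → ℝ => x t - f t.1) 1 (law T f) :=
  .of_map (X := id) (Measurable.aemeasurable (by fun_prop))
    (law_map_sub f t ▸ hasSubgaussianMGF_id_gaussianReal 1)

theorem iIndepFun_noise :
    iIndepFun (fun (t : Obs T) (x : Obs T → ℝ) => x t - f t.1) (law T f) :=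
  iIndepFun_pi (X := fun (t : Obs T) (y : ℝ) => y - f t.1) fun _ => by fun_prop

theorem hasSubgaussianMGF_noiseSum {p q : ℕ} (hq : q ≤ T) :
    HasSubgaussianMGF (fun x : Obs T → ℝ => noiseSum f x p q) (q - p : ℕ) (law T f) := by
  have hcard : ((Finset.univ.filter fun t : Obs T => p < t.1 ∧ t.1 ≤ q).card : ℝ) =
      (q - p : ℕ) := by
    simpa [blockSum] using blockSum_coe (T := T) (fun _ => 1) (p := p) hq
  have h := HasSubgaussianMGF.sum_of_iIndepFun (iIndepFun_noise f) (c := fun _ => 1)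
    (s := Finset.univ.filter fun t : Obs T => p < t.1 ∧ t.1 ≤ q)
    fun t _ => hasSubgaussianMGF_noise f t
  rwa [Finset.sum_const, nsmul_eq_mul, mul_one, Nat.cast_inj.1 hcard] at h

theorem law_lt_sq_noiseSum_le {p q : ℕ} (hpq : p < q) (hq : q ≤ T) (M : ℝ) :
    (law T f).real {x | M ^ 2 * ((q : ℝ) - p) < noiseSum f x p q ^ 2} ≤
      2 * Real.exp (-M ^ 2 / 2) := by
  have hpos : (0 : ℝ) < (q : ℝ) - p := sub_pos.2 (Nat.cast_lt.2 hpq)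
  have h := measureReal_abs_ge_le_two_mul_exp (hasSubgaussianMGF_noiseSum f (p := p) hq)
    (Real.sqrt_nonneg (M ^ 2 * ((q : ℝ) - p)))
  rw [Real.sq_sqrt (by positivity), NNReal.coe_natCast, Nat.cast_sub hpq.le, ← neg_mul,
    mul_div_mul_right _ _ hpos.ne'] at h
  refine (measureReal_mono fun x hx => ?_).trans h
  exact (Real.sqrt_le_sqrt hx.le).trans_eq (Real.sqrt_sq_eq_abs _)

theorem law_not_noiseBounded_le (M : ℝ) :
    (law T f).real {x | ¬ NoiseBounded T f M x} ≤ (T + 1) ^ 2 * (2 * Real.exp (-M ^ 2 / 2)) := by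
  set P := (Finset.range (T + 1) ×ˢ Finset.range (T + 1)).filter fun i => i.1 < i.2
  let B : ℕ × ℕ → Set (Obs T → ℝ) := fun i =>
    {x | M ^ 2 * ((i.2 : ℝ) - i.1) < noiseSum f x i.1 i.2 ^ 2}
  have hP : ∀ i, i ∈ P ↔ i.1 < i.2 ∧ i.2 ≤ T := fun i => by
    simp only [P, Finset.mem_filter, Finset.mem_product, Finset.mem_range]
    lia
  have hcard : (P.card : ℝ) ≤ (T + 1) ^ 2 := by
    refine mod_cast (Finset.card_filter_le _ _).trans_eq ?_
    rw [Finset.card_product, Finset.card_range, sq]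
  have hsub : {x | ¬ NoiseBounded T f M x} ⊆ ⋃ i ∈ P, B i := by
    intro x hx
    simp only [NoiseBounded, Set.mem_ofPred_eq, not_forall, not_le] at hx
    obtain ⟨p, q, hpq, hq, hlt⟩ := hx
    exact Set.mem_iUnion₂.2 ⟨(p, q), (hP _).2 ⟨hpq, hq⟩, hlt⟩
  calc (law T f).real {x | ¬ NoiseBounded T f M x} ≤ ∑ i ∈ P, (law T f).real (B i) :=
        (measureReal_mono hsub (measure_ne_top _ _)).trans (measureReal_biUnion_finset_le _ _)
    _ ≤ P.card • (2 * Real.exp (-M ^ 2 / 2)) := Finset.sum_le_card_nsmul _ _ _ fun i hi =>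
        law_lt_sq_noiseSum_le f ((hP i).1 hi).1 ((hP i).1 hi).2 M
    _ ≤ (T + 1) ^ 2 * (2 * Real.exp (-M ^ 2 / 2)) := by rw [nsmul_eq_mul]; gcongr

theorem law_not_noiseBounded_log_le (hT : 1 ≤ T) :
    (law T f).real {x | ¬ NoiseBounded T f (3 * √(Real.log T)) x} ≤ 8 / T := by
  have hT' : (1 : ℝ) ≤ T := Nat.one_le_cast.2 hT
  have hexp : Real.exp (-(3 * √(Real.log T)) ^ 2 / 2) ≤ ((T : ℝ) ^ 3)⁻¹ := by
    rw [← Real.exp_log (show (0 : ℝ) < ((T : ℝ) ^ 3)⁻¹ by positivity), Real.log_inv, Real.log_pow,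
      mul_pow, Real.sq_sqrt (Real.log_nonneg hT'), Real.exp_le_exp]
    norm_num
    linarith [Real.log_nonneg hT']
  have hsq : ((T : ℝ) + 1) ^ 2 ≤ 4 * (T : ℝ) ^ 2 := by nlinarith
  calc (law T f).real {x | ¬ NoiseBounded T f (3 * √(Real.log T)) x}
      ≤ (T + 1) ^ 2 * (2 * Real.exp (-(3 * √(Real.log T)) ^ 2 / 2)) :=
        law_not_noiseBounded_le f _
    _ ≤ 4 * (T : ℝ) ^ 2 * (2 * ((T : ℝ) ^ 3)⁻¹) := by gcongr
    _ = 8 / (T : ℝ) := by field_simp; ring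

end Noise

/-! ### Consistency -/

theorem one_sub_le_law_accurate {a : ℝ} {T m : ℕ} {f : ℕ → ℝ} (ha : 1 / 2 ≤ a) (ha1 : a < 1)
    (hT : 2 ≤ T) (hm2 : 2 ≤ m) (hm : (m : ℝ) ≤ a * minSpacing T f + 1)
    (hdet : Detectable 20736 T f) :
    1 - 8 / (T : ℝ) ≤ (law T f).real {x | ∀ S, IsOutput a m (30 * √(Real.log T)) x S →
      Accurate T f S (216 * Real.log T)} := by
  set M := 3 * √(Real.log T) with hM
  have hlog : 0 < Real.log T := Real.log_pos (Nat.one_lt_cast.2 hT)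
  have hM_sq : M ^ 2 = 9 * Real.log T := by
    rw [hM, mul_pow, Real.sq_sqrt hlog.le]; norm_num
  have hstrong : StrongChanges T f M := fun η hη => by
    rw [hM_sq]
    linarith [hdet.le_jump_sq hη]
  have hspacing : 2 ≤ minSpacing T f := by
    by_contra! hlt
    have hle : (minSpacing T f : ℝ) ≤ 1 := Nat.cast_le_one.2 (by lia)
    have : (2 : ℝ) ≤ m := Nat.ofNat_le_cast.2 hm2
    linarith [mul_le_mul_of_nonneg_left hle (show 0 ≤ a by linarith)]
  have hgood : {x | ¬ NoiseBounded T f M x}ᶜ ⊆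
      {x | ∀ S, IsOutput a m (30 * √(Real.log T)) x S → Accurate T f S (216 * Real.log T)} := by
    intro x hx S hS
    rw [show 30 * √(Real.log T) = 10 * M by rw [hM]; ring] at hS
    rw [show 216 * Real.log T = 24 * M ^ 2 by rw [hM_sq]; ring]
    exact accurate_of_noiseBounded ha ha1 (by positivity) (not_not.1 hx) hstrong hspacing hm hS
  have hcompl := measureReal_union_le (μ := law T f) {x | ¬ NoiseBounded T f M x}
    {x | ¬ NoiseBounded T f M x}ᶜ
  rw [Set.union_compl_self, probReal_univ] at hcompl
  linarith [law_not_noiseBounded_log_le f (one_le_two.trans hT),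
    measureReal_mono (μ := law T f) hgood]

theorem tendsto_law_accurate {a : ℝ} (ha : 1 / 2 ≤ a) (ha1 : a < 1) {m : ℕ → ℕ}
    (hm2 : ∀ T, 2 ≤ m T) {f : ℕ → ℕ → ℝ}
    (hm : ∀ᶠ T in atTop, (m T : ℝ) ≤ a * (minSpacing T (f T) : ℝ) + 1)
    (hdet : ∀ᶠ T in atTop, Detectable 20736 T (f T)) :
    Tendsto (fun T : ℕ => law T (f T) {x | ∀ S, IsOutput a (m T) (30 * √(Real.log T)) x S →
      Accurate T (f T) S (216 * Real.log T)}) atTop (nhds 1) := by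
  have hlim : Tendsto (fun T : ℕ => ENNReal.ofReal (1 - 8 / (T : ℝ))) atTop (nhds 1) := by
    simpa using ENNReal.tendsto_ofReal
      ((tendsto_const_nhds (x := (1 : ℝ))).sub
        (tendsto_const_div_atTop_nhds_zero_nat (8 : ℝ)))
  refine tendsto_of_tendsto_of_tendsto_of_le_of_le' hlim tendsto_const_nhds ?_
    (.of_forall fun T => prob_le_one)
  filter_upwards [hm, hdet, eventually_ge_atTop 2] with T hmT hdetT hT
  exact ENNReal.ofReal_le_of_le_toReal (one_sub_le_law_accurate ha ha1 hT (hm2 T) hmT hdetT)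

/-! ### Change of measure -/

section PiWithDensity

variable {ι : Type*} [Fintype ι] {X : ι → Type*} [∀ i, MeasurableSpace (X i)]
  (μ : ∀ i, Measure (X i)) [∀ i, IsProbabilityMeasure (μ i)] {h : ∀ i, X i → ENNReal}

theorem lintegral_prod_eval (hh : ∀ i, Measurable (h i)) :
    ∫⁻ x, ∏ i, h i (x i) ∂Measure.pi μ = ∏ i, ∫⁻ y, h i y ∂μ i := by
  rw [lintegral_prod_eq_prod_lintegral_of_indepFun Finset.univ (fun i (x : ∀ i, X i) => h i (x i))
    (iIndepFun_pi fun i => (hh i).aemeasurable) fun i => (hh i).comp (measurable_pi_apply i)]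
  exact Finset.prod_congr rfl fun i _ => (measurePreserving_eval μ i).lintegral_comp (hh i)

theorem pi_withDensity (hh : ∀ i, Measurable (h i)) [∀ i, SigmaFinite ((μ i).withDensity (h i))] :
    Measure.pi (fun i => (μ i).withDensity (h i)) =
      (Measure.pi μ).withDensity fun x => ∏ i, h i (x i) := by
  refine Measure.pi_eq fun s hs => ?_
  have hindicator : (Set.univ.pi s).indicator (fun x : ∀ i, X i => ∏ i, h i (x i)) =
      fun x => ∏ i, (s i).indicator (h i) (x i) := by
    classical
    funext x
    simp only [Set.indicator_apply, Finset.prod_ite_zero, Set.mem_univ_pi, Finset.mem_univ,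
      forall_true_left]
  rw [withDensity_apply _ (MeasurableSet.univ_pi hs),
    ← lintegral_indicator (MeasurableSet.univ_pi hs), hindicator,
    lintegral_prod_eval μ fun i => (hh i).indicator (hs i)]
  exact Finset.prod_congr rfl fun i _ => by
    rw [lintegral_indicator (hs i), withDensity_apply _ (hs i)]

end PiWithDensity

theorem gaussianReal_eq_withDensity (m m' : ℝ) :
    gaussianReal m' 1 = (gaussianReal m 1).withDensity fun y =>
      ENNReal.ofReal (Real.exp ((m' - m) * (y - m) - (m' - m) ^ 2 / 2)) := by
  rw [gaussianReal_of_var_ne_zero _ one_ne_zero, gaussianReal_of_var_ne_zero _ one_ne_zero,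
    ← withDensity_mul _ (measurable_gaussianPDF _ _) (by fun_prop)]
  congr 1
  funext y
  rw [Pi.mul_apply, gaussianPDF, gaussianPDF, ← ENNReal.ofReal_mul (gaussianPDFReal_nonneg _ _ _),
    gaussianPDFReal, gaussianPDFReal, mul_assoc (√_)⁻¹, ← Real.exp_add, NNReal.coe_one]
  congr 3
  ring

section Likelihood

variable {T : ℕ} (f g h : ℕ → ℝ)

/-- The density of `law T g` with respect to `law T f`. -/
noncomputable def likelihood (x : Obs T → ℝ) : ℝ :=
  Real.exp (∑ t : Obs T, ((g t.1 - f t.1) * (x t - f t.1) - (g t.1 - f t.1) ^ 2 / 2))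

theorem likelihood_nonneg (x : Obs T → ℝ) : 0 ≤ likelihood f g x := (Real.exp_pos _).le

theorem measurable_likelihood : Measurable (likelihood (T := T) f g) := by
  unfold likelihood
  fun_prop

theorem law_eq_withDensity :
    law T g = (law T f).withDensity fun x => ENNReal.ofReal (likelihood f g x) := by
  have hdensity (t : Obs T) := gaussianReal_eq_withDensity (f t.1) (g t.1)
  have (t : Obs T) : SigmaFinite ((gaussianReal (f t.1) 1).withDensity fun y =>
      ENNReal.ofReal (Real.exp ((g t.1 - f t.1) * (y - f t.1) - (g t.1 - f t.1) ^ 2 / 2))) := by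
    rw [← hdensity]; infer_instance
  simp only [law, hdensity]
  rw [pi_withDensity (fun t : Obs T => gaussianReal (f t.1) 1) fun t => by fun_prop]
  congr 1
  funext x
  rw [← ENNReal.ofReal_prod_of_nonneg fun _ _ => (Real.exp_pos _).le, likelihood, Real.exp_sum]

theorem law_real_eq_setIntegral {B : Set (Obs T → ℝ)} (hB : MeasurableSet B) :
    (law T g).real B = ∫ x in B, likelihood f g x ∂law T f := by
  rw [integral_eq_lintegral_of_nonneg_ae (ae_of_all _ (likelihood_nonneg f g))
    (measurable_likelihood f g).aestronglyMeasurable, measureReal_def, ← withDensity_apply _ hB,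
    ← law_eq_withDensity f g]

theorem integral_likelihood : ∫ x, likelihood f g x ∂law T f = 1 := by
  rw [← setIntegral_univ, ← law_real_eq_setIntegral f g MeasurableSet.univ, probReal_univ]

theorem integrable_likelihood : Integrable (likelihood f g) (law T f) :=
  .of_integral_ne_zero (by rw [integral_likelihood]; exact one_ne_zero)

theorem likelihood_mul (x : Obs T → ℝ) :
    likelihood f g x * likelihood f h x =
      Real.exp (∑ t : Obs T, (g t.1 - f t.1) * (h t.1 - f t.1)) *
        likelihood f (fun t => g t + h t - f t) x := by
  rw [likelihood, likelihood, likelihood, ← Real.exp_add, ← Real.exp_add,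
    ← Finset.sum_add_distrib, ← Finset.sum_add_distrib]
  congr 1
  exact Finset.sum_congr rfl fun t _ => by ring

theorem integrable_likelihood_mul :
    Integrable (fun x => likelihood f g x * likelihood f h x) (law T f) := by
  simp only [likelihood_mul]
  exact (integrable_likelihood _ _).const_mul _

theorem integral_likelihood_mul :
    ∫ x, likelihood f g x * likelihood f h x ∂law T f =
      Real.exp (∑ t : Obs T, (g t.1 - f t.1) * (h t.1 - f t.1)) := by
  simp only [likelihood_mul]
  rw [integral_const_mul, integral_likelihood, mul_one]

theorem integrable_likelihood_sub_one :
    Integrable (fun x => likelihood f g x - 1) (law T f) :=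
  (integrable_likelihood f g).sub (integrable_const 1)

theorem likelihood_sub_one_mul (x : Obs T → ℝ) :
    (likelihood f g x - 1) * (likelihood f h x - 1) =
      likelihood f g x * likelihood f h x - likelihood f g x - (likelihood f h x - 1) := by
  ring

theorem integrable_likelihood_sub_one_mul :
    Integrable (fun x => (likelihood f g x - 1) * (likelihood f h x - 1)) (law T f) := by
  simp only [likelihood_sub_one_mul]
  exact ((integrable_likelihood_mul f g h).sub (integrable_likelihood f g)).sub
    (integrable_likelihood_sub_one f h)

theorem integral_likelihood_sub_one_mul :
    ∫ x, (likelihood f g x - 1) * (likelihood f h x - 1) ∂law T f =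
      Real.exp (∑ t : Obs T, (g t.1 - f t.1) * (h t.1 - f t.1)) - 1 := by
  simp only [likelihood_sub_one_mul]
  rw [integral_sub _ (integrable_likelihood_sub_one f h),
    integral_sub (integrable_likelihood_mul f g h) (integrable_likelihood f g),
    integral_sub (integrable_likelihood f h) (integrable_const 1), integral_likelihood_mul,
    integral_likelihood, integral_likelihood]
  · simp
  · exact (integrable_likelihood_mul f g h).sub (integrable_likelihood f g)

end Likelihood

/-! ### Mixtures of orthogonal perturbations -/

theorem setIntegral_le_integral_sq_div_add {Ω : Type*} {mΩ : MeasurableSpace Ω} {μ : Measure Ω}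
    [IsProbabilityMeasure μ] {W : Ω → ℝ} (hW : Integrable W μ)
    (hW_sq : Integrable (fun x => W x ^ 2) μ) {c : ℝ} (hc : 0 < c) (B : Set Ω) :
    ∫ x in B, W x ∂μ ≤ (∫ x, W x ^ 2 ∂μ) / c + c / 4 := by
  have hmaj : Integrable (fun x => W x ^ 2 / c + c / 4) μ :=
    (hW_sq.div_const _).add (integrable_const _)
  have hle : ∀ x, W x ≤ W x ^ 2 / c + c / 4 := fun x => by
    have hsq : W x ^ 2 / c + c / 4 - W x = (W x - c / 2) ^ 2 / c := by
      field_simp; ring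
    have : 0 ≤ (W x - c / 2) ^ 2 / c := by positivity
    linarith
  calc ∫ x in B, W x ∂μ ≤ ∫ x in B, (W x ^ 2 / c + c / 4) ∂μ :=
        setIntegral_mono hW.integrableOn hmaj.integrableOn hle
    _ ≤ ∫ x, (W x ^ 2 / c + c / 4) ∂μ :=
        setIntegral_le_integral hmaj (ae_of_all _ fun x => by
          simp only [Pi.zero_apply]; positivity)
    _ = (∫ x, W x ^ 2 ∂μ) / c + c / 4 := by
        rw [integral_add (hW_sq.div_const _) (integrable_const _), integral_div]
        simp

section Mixture

variable {T : ℕ} {ι : Type*} [Fintype ι] (f : ℕ → ℝ) (g : ι → ℕ → ℝ) {v : ℝ}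

theorem sq_sum_likelihood_sub_one (x : Obs T → ℝ) :
    (∑ i, (likelihood f (g i) x - 1)) ^ 2 =
      ∑ i, ∑ j, (likelihood f (g i) x - 1) * (likelihood f (g j) x - 1) := by
  rw [sq, Finset.sum_mul_sum]

theorem integrable_sum_likelihood_sub_one :
    Integrable (fun x => ∑ i, (likelihood f (g i) x - 1)) (law T f) :=
  integrable_finsetSum _ fun i _ => integrable_likelihood_sub_one f (g i)

theorem integrable_sq_sum_likelihood_sub_one :
    Integrable (fun x => (∑ i, (likelihood f (g i) x - 1)) ^ 2) (law T f) := by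
  simp only [sq_sum_likelihood_sub_one]
  exact integrable_finsetSum _ fun i _ => integrable_finsetSum _ fun j _ =>
    integrable_likelihood_sub_one_mul f (g i) (g j)

variable {f g}

theorem integral_sq_sum_likelihood_sub_one_le
    (horth : ∀ i j, i ≠ j → ∑ t : Obs T, (g i t.1 - f t.1) * (g j t.1 - f t.1) = 0)
    (hv : ∀ i, ∑ t : Obs T, (g i t.1 - f t.1) ^ 2 ≤ v) :
    ∫ x, (∑ i, (likelihood f (g i) x - 1)) ^ 2 ∂law T f ≤ Fintype.card ι * Real.exp v := by
  have hint (i j) := integrable_likelihood_sub_one_mul (T := T) f (g i) (g j)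
  simp only [sq_sum_likelihood_sub_one]
  rw [integral_finsetSum _ fun i _ => integrable_finsetSum _ fun j _ => hint i j,
    ← nsmul_eq_mul, ← Finset.card_univ]
  refine Finset.sum_le_card_nsmul _ _ _ fun i _ => ?_
  rw [integral_finsetSum _ fun j _ => hint i j]
  simp only [integral_likelihood_sub_one_mul]
  rw [Finset.sum_eq_single i]
  · have hi : ∑ t : Obs T, (g i t.1 - f t.1) * (g i t.1 - f t.1) ≤ v := by
      simpa only [sq] using hv i
    linarith [Real.exp_le_exp.2 hi]
  · intro j _ hji
    rw [horth i j hji.symm, Real.exp_zero, sub_self]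
  · exact fun hi => absurd (Finset.mem_univ i) hi

theorem sum_law_sub_law_eq_setIntegral {B : Set (Obs T → ℝ)} (hB : MeasurableSet B) :
    ∑ i, ((law T (g i)).real B - (law T f).real B) =
      ∫ x in B, ∑ i, (likelihood f (g i) x - 1) ∂law T f := by
  rw [integral_finsetSum _ fun i _ => (integrable_likelihood_sub_one f (g i)).integrableOn]
  refine Finset.sum_congr rfl fun i _ => ?_
  rw [integral_sub (integrable_likelihood f (g i)).integrableOn (integrable_const 1),
    ← law_real_eq_setIntegral f (g i) hB]
  simp

theorem exists_law_le_add_half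
    (horth : ∀ i j, i ≠ j → ∑ t : Obs T, (g i t.1 - f t.1) * (g j t.1 - f t.1) = 0)
    (hv : ∀ i, ∑ t : Obs T, (g i t.1 - f t.1) ^ 2 ≤ v) (hcard : Real.exp v ≤ Fintype.card ι / 4)
    {B : Set (Obs T → ℝ)} (hB : MeasurableSet B) :
    ∃ i, (law T (g i)).real B ≤ (law T f).real B + 1 / 2 := by
  have hpos : (0 : ℝ) < Fintype.card ι := by linarith [Real.exp_pos v]
  have : Nonempty ι := Fintype.card_pos_iff.1 (Nat.cast_pos.1 hpos)
  have hsum : ∑ i, ((law T (g i)).real B - (law T f).real B) ≤ ∑ _i : ι, (1 / 2 : ℝ) := by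
    calc ∑ i, ((law T (g i)).real B - (law T f).real B)
        = ∫ x in B, ∑ i, (likelihood f (g i) x - 1) ∂law T f :=
          sum_law_sub_law_eq_setIntegral hB
      _ ≤ (∫ x, (∑ i, (likelihood f (g i) x - 1)) ^ 2 ∂law T f) / Fintype.card ι +
            Fintype.card ι / 4 :=
          setIntegral_le_integral_sq_div_add (integrable_sum_likelihood_sub_one f g)
            (integrable_sq_sum_likelihood_sub_one f g) hpos B
      _ ≤ Real.exp v + Fintype.card ι / 4 := by
          gcongr
          rw [div_le_iff₀' hpos]
          exact integral_sq_sum_likelihood_sub_one_le horth hv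
      _ ≤ ∑ _i : ι, (1 / 2 : ℝ) := by
          rw [Finset.sum_const, Finset.card_univ, nsmul_eq_mul]
          linarith
  obtain ⟨i, -, hi⟩ := Finset.exists_le_of_sum_le Finset.univ_nonempty hsum
  exact ⟨i, by linarith⟩

theorem law_le_or_exists_law_le
    (horth : ∀ i j, i ≠ j → ∑ t : Obs T, (g i t.1 - f t.1) * (g j t.1 - f t.1) = 0)
    (hv : ∀ i, ∑ t : Obs T, (g i t.1 - f t.1) ^ 2 ≤ v) (hcard : Real.exp v ≤ Fintype.card ι / 4)
    {B : Set (Obs T → ℝ)} (hB : MeasurableSet B)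
    {E : ι → Set (Obs T → ℝ)} (hE : ∀ i, Disjoint (E i) B) :
    law T f B ≤ ENNReal.ofReal (3 / 4) ∨ ∃ i, law T (g i) (E i) ≤ ENNReal.ofReal (3 / 4) := by
  have hreal (μ : Measure (Obs T → ℝ)) [IsFiniteMeasure μ] (A : Set (Obs T → ℝ)) :
      μ A ≤ ENNReal.ofReal (3 / 4) ↔ μ.real A ≤ 3 / 4 :=
    ENNReal.le_ofReal_iff_toReal_le (measure_ne_top _ _) (by norm_num)
  refine or_iff_not_imp_left.2 fun hf => ?_
  rw [hreal, not_le] at hf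
  obtain ⟨i, hi⟩ := exists_law_le_add_half horth hv hcard hB.compl
  rw [probReal_compl_eq_one_sub (μ := law T f) hB] at hi
  refine ⟨i, (measure_mono (Set.subset_compl_iff_disjoint_right.2 (hE i))).trans ?_⟩
  rw [hreal]
  linarith

end Mixture

/-! ### Bumps -/

/-- The signal of height `δ` on `(p, p + u]` and zero elsewhere; the perturbations in both lower
bounds are of this form. -/
noncomputable def bump (δ : ℝ) (p u t : ℕ) : ℝ := if t ∈ Finset.Ioc p (p + u) then δ else 0

section Bump

variable {T p u : ℕ} {δ : ℝ}

theorem sum_sq_bump_le : ∑ t : Obs T, bump δ p u t.1 ^ 2 ≤ u * δ ^ 2 := by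
  rw [Finset.sum_coe_sort (Finset.Icc 1 T) fun t => bump δ p u t ^ 2]
  simp only [bump, ite_pow, ne_eq, OfNat.ofNat_ne_zero, not_false_eq_true, zero_pow]
  rw [← Finset.sum_filter, Finset.sum_const, nsmul_eq_mul]
  gcongr
  refine (Finset.card_le_card fun t ht => (Finset.mem_filter.1 ht).2).trans_eq ?_
  rw [Nat.card_Ioc, Nat.add_sub_cancel_left]

theorem bump_mul_bump_eq_zero {w i j : ℕ} (hu : u ≤ w) (hij : i ≠ j) (t : ℕ) :
    bump δ (w * (i + 1)) u t * bump δ (w * (j + 1)) u t = 0 := by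
  have hstep {i j : ℕ} (hij : i < j) : w * (i + 1) + w ≤ w * (j + 1) :=
    Nat.mul_le_mul_left w (show i + 2 ≤ j + 1 by lia)
  have hdisj : t ∉ Finset.Ioc (w * (i + 1)) (w * (i + 1) + u) ∨
      t ∉ Finset.Ioc (w * (j + 1)) (w * (j + 1) + u) := by
    simp only [Finset.mem_Ioc]
    rcases hij.lt_or_gt with h | h
    · have := hstep h; lia
    · have := hstep h; lia
  rcases hdisj with h | h
  · rw [bump, if_neg h, zero_mul]
  · rw [mul_comm, bump, if_neg h, zero_mul]

theorem eq_or_eq_of_mem_changePoints_bump {x : ℕ} (hx : x ∈ changePoints T (bump δ p u)) :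
    x = p ∨ x = p + u := by
  by_contra hne
  refine (mem_changePoints.1 hx).2 ?_
  simp only [bump, Finset.mem_Ioc]
  congr 1
  rw [eq_iff_iff]
  lia

theorem self_mem_changePoints_bump (hδ : δ ≠ 0) (hp : 1 ≤ p) (hu : 1 ≤ u) (hpT : p < T) :
    p ∈ changePoints T (bump δ p u) := by
  refine mem_changePoints.2 ⟨⟨hp, hpT⟩, ?_⟩
  simpa [bump, hu] using hδ

theorem abs_jump_bump (hu : 1 ≤ u) {x : ℕ} (hx : x = p ∨ x = p + u) :
    |bump δ p u (x + 1) - bump δ p u x| = |δ| := by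
  rcases hx with rfl | rfl
  · simp [bump, hu]
  · simp [bump, show 0 < u from hu]

theorem le_minSpacing_bump (hp : u ≤ p) (hpT : p + 2 * u ≤ T) :
    u ≤ minSpacing T (bump δ p u) := by
  refine le_minSpacing (by lia) (fun x hx => ?_) fun x hx y hy hxy => ?_
  · have := eq_or_eq_of_mem_changePoints_bump hx
    lia
  · have := eq_or_eq_of_mem_changePoints_bump hx
    have := eq_or_eq_of_mem_changePoints_bump hy
    lia

theorem detectable_bump {C : ℝ} (hu : 1 ≤ u) (hp : u ≤ p) (hpT : p + 2 * u ≤ T)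
    (hC : C * Real.log T ≤ u * δ ^ 2) : Detectable C T (bump δ p u) := by
  refine detectable_of_forall_jump (abs_nonneg δ) (fun x hx => ?_) (le_minSpacing_bump hp hpT) ?_
  · exact (abs_jump_bump hu (eq_or_eq_of_mem_changePoints_bump hx)).ge
  · rwa [sq_abs, mul_comm (δ ^ 2)]

end Bump

theorem sqrt_le_div_sub_two_div_four {T w : ℕ} (hw : 1 ≤ w) (hT : (7 * w) ^ 2 ≤ T) :
    √(T : ℝ) ≤ (T / w - 2 : ℕ) / 4 := by
  have hw' : (1 : ℝ) ≤ w := Nat.one_le_cast.2 hw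
  have hw_sqrt : 7 * (w : ℝ) ≤ √T := Real.le_sqrt_of_sq_le (mod_cast hT)
  have hdiv : (T : ℝ) < w * ((T / w - 2 : ℕ) + 3) := by
    have hlt : T < w * (T / w + 1) := Nat.lt_mul_div_succ T hw
    exact_mod_cast hlt.trans_le (Nat.mul_le_mul_left w (by lia))
  have hmul : (w : ℝ) * (7 * √T) < w * ((T / w - 2 : ℕ) + 3) := by
    refine lt_of_le_of_lt ?_ hdiv
    calc (w : ℝ) * (7 * √T) = 7 * w * √T := by ring
      _ ≤ √T * √T := by gcongr
      _ = T := Real.mul_self_sqrt T.cast_nonneg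
  linarith [lt_of_mul_lt_mul_left hmul (by linarith)]

theorem exp_half_mul_log {x : ℝ} (hx : 0 < x) : Real.exp (1 / 2 * Real.log x) = √x := by
  rw [Real.sqrt_eq_rpow, Real.rpow_def_of_pos hx, mul_comm]

theorem law_le_or_exists_law_le_of_bump {T w u : ℕ} {δ : ℝ} (hw : 1 ≤ w) (hu : u ≤ w)
    (hT : (7 * w) ^ 2 ≤ T) (hδ : u * δ ^ 2 ≤ 1 / 2 * Real.log T) {f : ℕ → ℝ}
    {g : Fin (T / w - 2) → ℕ → ℝ} (hg : ∀ i t, g i t - f t = bump δ (w * (i + 1)) u t)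
    {B : Set (Obs T → ℝ)} (hB : MeasurableSet B) {E : Fin (T / w - 2) → Set (Obs T → ℝ)}
    (hE : ∀ i, Disjoint (E i) B) :
    law T f B ≤ ENNReal.ofReal (3 / 4) ∨ ∃ i, law T (g i) (E i) ≤ ENNReal.ofReal (3 / 4) := by
  have hTpos : 0 < T := lt_of_lt_of_le (by positivity) hT
  refine law_le_or_exists_law_le (v := 1 / 2 * Real.log T) (fun i j hij => ?_) (fun i => ?_) ?_
    hB hE
  · simp only [hg]
    exact Finset.sum_eq_zero fun t _ => bump_mul_bump_eq_zero hu (Fin.val_ne_of_ne hij) t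
  · simp only [hg]
    exact sum_sq_bump_le.trans hδ
  · rw [exp_half_mul_log (Nat.cast_pos.2 hTpos), Fintype.card_fin]
    exact sqrt_le_div_sub_two_div_four hw hT

/-! ### Short bumps are not detectable -/

theorem changePoints_zero (T : ℕ) : changePoints T (fun _ => 0) = ∅ := by
  simp [changePoints]

theorem numChanges_zero (T : ℕ) : numChanges T (fun _ => 0) = 0 := by
  rw [numChanges, changePoints_zero, Finset.card_empty]

theorem le_minSpacing_zero (T : ℕ) : T ≤ minSpacing T (fun _ => 0) :=
  le_minSpacing le_rfl (by simp [changePoints_zero]) (by simp [changePoints_zero])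

theorem detectable_zero (C : ℝ) (T : ℕ) : Detectable C T (fun _ => 0) := fun h =>
  absurd (numChanges_zero T) h.ne'

theorem detection_lower_bound {T : ℕ} (hT : 196 ≤ T) {Nhat : (Obs T → ℝ) → ℕ}
    (hN : Measurable Nhat) :
    ∃ f : ℕ → ℝ, 2 ≤ minSpacing T f ∧ Detectable (1 / 2) T f ∧
      law T f {x | Nhat x = numChanges T f} ≤ ENNReal.ofReal (3 / 4) := by
  have hlog : 0 < Real.log T := Real.log_pos (Nat.one_lt_cast.2 (by lia))
  obtain ⟨δ, hδ, hδ_sq⟩ : ∃ δ : ℝ, 0 < δ ∧ (2 : ℕ) * δ ^ 2 = 1 / 2 * Real.log T :=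
    ⟨√(1 / 4 * Real.log T), by positivity, by
      rw [Real.sq_sqrt (by positivity)]; push_cast; ring⟩
  have hnum (j : Fin (T / 2 - 2)) : numChanges T (bump δ (2 * (j + 1)) 2) ≠ 0 :=
    Finset.card_ne_zero_of_mem
      (self_mem_changePoints_bump hδ.ne' (by lia) one_le_two (by lia))
  rcases law_le_or_exists_law_le_of_bump one_le_two le_rfl hT hδ_sq.le (f := fun _ => 0)
      (g := fun j => bump δ (2 * (j + 1)) 2) (fun j t => sub_zero _)
      (B := {x | Nhat x = numChanges T fun _ => 0}) (hN (measurableSet_singleton _))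
      (E := fun j => {x | Nhat x = numChanges T (bump δ (2 * (j + 1)) 2)}) fun j =>
        Set.disjoint_left.2 fun x (hx : Nhat x = _) (hx₀ : Nhat x = _) =>
          hnum j (hx.symm.trans (hx₀.trans (numChanges_zero T)))
    with h | ⟨j, hj⟩
  · exact ⟨_, le_trans (by lia) (le_minSpacing_zero T), detectable_zero _ T, h⟩
  · exact ⟨_, le_minSpacing_bump (by lia) (by lia),
      detectable_bump one_le_two (by lia) (by lia) hδ_sq.ge, hj⟩

/-! ### Staircases cannot be localised faster -/

theorem measurableSet_preimage_of_countable {α β : Type*} [MeasurableSpace α] [Countable β]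
    {g : α → β} (hg : ∀ b, MeasurableSet (g ⁻¹' {b})) (A : Set β) : MeasurableSet (g ⁻¹' A) := by
  let _ : MeasurableSpace β := ⊤
  exact measurable_to_countable' hg trivial

/-- The staircase with `n` steps of height `δ` at the locations `g 0 < g 1 < …`. -/
noncomputable def stair (δ : ℝ) (n : ℕ) (g : ℕ → ℕ) (t : ℕ) : ℝ :=
  ∑ i ∈ Finset.range n, if g i < t then δ else 0

section Stair

variable {T n i k : ℕ} {δ : ℝ} {g : ℕ → ℕ}

theorem stair_succ_sub (δ : ℝ) (n : ℕ) (g : ℕ → ℕ) (t : ℕ) :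
    stair δ n g (t + 1) - stair δ n g t = ∑ i ∈ Finset.range n, if g i = t then δ else 0 := by
  rw [stair, stair, ← Finset.sum_sub_distrib]
  refine Finset.sum_congr rfl fun i _ => ?_
  rcases lt_trichotomy (g i) t with h | h | h
  · simp [h, h.ne, h.trans t.lt_succ_self]
  · simp [h]
  · rw [if_neg (by lia), if_neg (by lia), if_neg (by lia), sub_zero]

theorem stair_jump (hg : StrictMono g) (hi : i < n) :
    stair δ n g (g i + 1) - stair δ n g (g i) = δ := by
  simp only [stair_succ_sub, hg.injective.eq_iff]
  rw [Finset.sum_ite_eq', if_pos (Finset.mem_range.2 hi)]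

theorem exists_eq_of_mem_changePoints_stair {x : ℕ} (hx : x ∈ changePoints T (stair δ n g)) :
    ∃ i < n, g i = x := by
  by_contra! hne
  refine (mem_changePoints.1 hx).2 (sub_eq_zero.1 ?_)
  rw [stair_succ_sub]
  exact Finset.sum_eq_zero fun i hi => if_neg (hne i (Finset.mem_range.1 hi))

theorem changePoints_stair (hδ : δ ≠ 0) (hg : StrictMono g) (hgT : ∀ i < n, 1 ≤ g i ∧ g i < T) :
    changePoints T (stair δ n g) = (Finset.range n).image g := by
  ext x
  simp only [Finset.mem_image, Finset.mem_range]
  refine ⟨exists_eq_of_mem_changePoints_stair, ?_⟩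
  rintro ⟨i, hi, rfl⟩
  refine mem_changePoints.2 ⟨hgT i hi, fun h => hδ ?_⟩
  rw [← stair_jump (δ := δ) hg hi, h, sub_self]

theorem numChanges_stair (hδ : δ ≠ 0) (hg : StrictMono g) (hgT : ∀ i < n, 1 ≤ g i ∧ g i < T) :
    numChanges T (stair δ n g) = n := by
  rw [numChanges, changePoints_stair hδ hg hgT, Finset.card_image_of_injective _ hg.injective,
    Finset.card_range]

theorem eta_stair (hδ : δ ≠ 0) (hg : StrictMono g) (hgT : ∀ i < n, 1 ≤ g i ∧ g i < T)
    (hi : i < n) : eta T (stair δ n g) (i + 1) = g i := by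
  have hcard : (changePoints T (stair δ n g)).card = n := numChanges_stair hδ hg hgT
  refine loc_eq_of_strictMono hcard (fun j : Fin n => g j) (fun j k hjk => hg hjk)
    (fun j => ?_) ⟨i, hi⟩
  rw [changePoints_stair hδ hg hgT]
  exact Finset.mem_image_of_mem _ (Finset.mem_range.2 j.2)

theorem mul_abs_loc_sub_le_of_accurate_stair {S : Finset ℕ} {B : ℝ} (hδ : δ ≠ 0)
    (hg : StrictMono g) (hgT : ∀ i < n, 1 ≤ g i ∧ g i < T)
    (hS : Accurate T (stair δ n g) S B) (hi : i < n) :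
    δ ^ 2 * |(loc T S (i + 1) : ℝ) - g i| ≤ B := by
  have h := hS.2 (i + 1) (by rw [numChanges_stair hδ hg hgT, Finset.mem_Icc]; lia)
  rwa [jump, eta_stair hδ hg hgT hi, stair_jump hg hi, sq_abs] at h

theorem sq_le_of_accurate_stair_of_accurate_stair {S : Finset ℕ} {B : ℝ} {g' : ℕ → ℕ} (hδ : δ ≠ 0)
    (hg : StrictMono g) (hgT : ∀ i < n, 1 ≤ g i ∧ g i < T) (hS : Accurate T (stair δ n g) S B)
    (hg' : StrictMono g') (hgT' : ∀ i < n, 1 ≤ g' i ∧ g' i < T)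
    (hS' : Accurate T (stair δ n g') S B) (hi : i < n) (hne : g i ≠ g' i) : δ ^ 2 ≤ 2 * B := by
  have hdist : (1 : ℝ) ≤ |(g i : ℝ) - g' i| := by
    exact_mod_cast Int.one_le_abs (sub_ne_zero.2 (Nat.cast_injective.ne hne))
  have htriangle := abs_sub_le (g i : ℝ) (loc T S (i + 1)) (g' i)
  rw [abs_sub_comm (g i : ℝ) (loc T S (i + 1))] at htriangle
  calc δ ^ 2 ≤ δ ^ 2 * (|(loc T S (i + 1) : ℝ) - g i| + |(loc T S (i + 1) : ℝ) - g' i|) :=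
        le_mul_of_one_le_right (sq_nonneg δ) (hdist.trans htriangle)
    _ ≤ 2 * B := by
        linarith [mul_abs_loc_sub_le_of_accurate_stair hδ hg hgT hS hi,
          mul_abs_loc_sub_le_of_accurate_stair hδ hg' hgT' hS' hi]

theorem le_minSpacing_stair (hk : 1 ≤ k) (hkT : k ≤ T) (hgk : ∀ i, g i + k ≤ g (i + 1))
    (hgT : ∀ i < n, k ≤ g i ∧ g i + k ≤ T) : k ≤ minSpacing T (stair δ n g) := by
  have hg : StrictMono g := strictMono_nat_of_lt_succ fun i => by have := hgk i; lia
  refine le_minSpacing hkT (fun x hx => ?_) (fun x hx y hy hxy => ?_)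
  · obtain ⟨i, hi, rfl⟩ := exists_eq_of_mem_changePoints_stair hx
    exact hgT i hi
  · obtain ⟨i, -, rfl⟩ := exists_eq_of_mem_changePoints_stair hx
    obtain ⟨j, -, rfl⟩ := exists_eq_of_mem_changePoints_stair hy
    exact (hgk i).trans (hg.monotone (hg.lt_iff_lt.1 hxy))

theorem detectable_stair {C : ℝ} (hk : 1 ≤ k) (hkT : k ≤ T) (hgk : ∀ i, g i + k ≤ g (i + 1))
    (hgT : ∀ i < n, k ≤ g i ∧ g i + k ≤ T) (hC : C * Real.log T ≤ δ ^ 2 * k) :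
    Detectable C T (stair δ n g) := by
  have hg : StrictMono g := strictMono_nat_of_lt_succ fun i => by have := hgk i; lia
  rw [← sq_abs] at hC
  refine detectable_of_forall_jump (abs_nonneg δ) (fun x hx => ?_)
    (le_minSpacing_stair hk hkT hgk hgT) hC
  obtain ⟨i, hi, rfl⟩ := exists_eq_of_mem_changePoints_stair hx
  rw [stair_jump hg hi]

end Stair

/-- The equidistant locations `w, 2 w, 3 w, …`, the `j`-th of them shifted to the right by one for
`some j`. -/
def shiftedGrid (w : ℕ) (j : Option ℕ) (i : ℕ) : ℕ := w * (i + 1) + if j = some i then 1 else 0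

section ShiftedGrid

variable {T n w : ℕ}

theorem shiftedGrid_none (w i : ℕ) : shiftedGrid w none i = w * (i + 1) := by
  simp [shiftedGrid]

theorem shiftedGrid_self (w i : ℕ) : shiftedGrid w (some i) i = w * (i + 1) + 1 := by
  simp [shiftedGrid]

theorem shiftedGrid_of_ne {i j : ℕ} (hij : i ≠ j) : shiftedGrid w (some j) i = w * (i + 1) := by
  simp [shiftedGrid, hij.symm]

theorem shiftedGrid_bounds (w : ℕ) (j : Option ℕ) (i : ℕ) :
    w * (i + 1) ≤ shiftedGrid w j i ∧ shiftedGrid w j i ≤ w * (i + 1) + 1 := by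
  rw [shiftedGrid]; split_ifs <;> lia

theorem shiftedGrid_add_le (hw : 1 ≤ w) (j : Option ℕ) (i : ℕ) :
    shiftedGrid w j i + (w - 1) ≤ shiftedGrid w j (i + 1) := by
  have := shiftedGrid_bounds w j i
  have := shiftedGrid_bounds w j (i + 1)
  have : w * (i + 1 + 1) = w * (i + 1) + w := by ring
  lia

theorem strictMono_shiftedGrid (hw : 2 ≤ w) (j : Option ℕ) : StrictMono (shiftedGrid w j) :=
  strictMono_nat_of_lt_succ fun i => by
    have := shiftedGrid_add_le (one_le_two.trans hw) j i
    lia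

theorem le_shiftedGrid_and_add_le (hw : 1 ≤ w) (hT : w * (n + 1) ≤ T) (j : Option ℕ) :
    ∀ i < n, w - 1 ≤ shiftedGrid w j i ∧ shiftedGrid w j i + (w - 1) ≤ T := by
  intro i hi
  have := shiftedGrid_bounds w j i
  have : w * (i + 1) ≤ w * n := Nat.mul_le_mul_left w hi
  have : w * (n + 1) = w * n + w := by ring
  have : w * (i + 1) = w * i + w := by ring
  lia

theorem one_le_shiftedGrid_and_lt (hw : 2 ≤ w) (hT : w * (n + 1) ≤ T) (j : Option ℕ) :
    ∀ i < n, 1 ≤ shiftedGrid w j i ∧ shiftedGrid w j i < T := by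
  intro i hi
  have := le_shiftedGrid_and_add_le (one_le_two.trans hw) hT j i hi
  lia

theorem stair_shiftedGrid_sub (δ : ℝ) {j : ℕ} (hj : j < n) (t : ℕ) :
    stair δ n (shiftedGrid w (some j)) t - stair δ n (shiftedGrid w none) t =
      bump (-δ) (w * (j + 1)) 1 t := by
  rw [stair, stair, ← Finset.sum_sub_distrib, Finset.sum_eq_single_of_mem j (Finset.mem_range.2 hj),
    shiftedGrid_none, shiftedGrid_self]
  · simp only [bump, Finset.mem_Ioc]
    split_ifs <;> first | lia | simp
  · intro i _ hij
    rw [shiftedGrid_of_ne hij, shiftedGrid_none, sub_self]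

end ShiftedGrid

theorem localisation_lower_bound {C : ℝ} {T w : ℕ} (hw : 3 ≤ w) (hwC : 2 * C + 1 ≤ w)
    (hT : (7 * w) ^ 2 ≤ T) {est : (Obs T → ℝ) → Finset ℕ}
    (hest : ∀ S, MeasurableSet (est ⁻¹' {S})) :
    ∃ f : ℕ → ℝ, 2 ≤ minSpacing T f ∧ Detectable C T f ∧
      law T f {x | Accurate T f (est x) (1 / 8 * Real.log T)} ≤ ENNReal.ofReal (3 / 4) := by
  have hwT : 49 * w ≤ T := by nlinarith
  have hlog : 0 < Real.log T := Real.log_pos (Nat.one_lt_cast.2 (by lia))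
  obtain ⟨δ, hδ, hδ_sq⟩ : ∃ δ : ℝ, 0 < δ ∧ δ ^ 2 = 1 / 2 * Real.log T :=
    ⟨√(1 / 2 * Real.log T), by positivity, Real.sq_sqrt (by positivity)⟩
  have hdiv : 49 ≤ T / w := (Nat.le_div_iff_mul_le (by lia)).2 hwT
  have hnT : w * (T / w - 2 + 1) ≤ T :=
    (Nat.mul_le_mul_left w (by lia)).trans (Nat.mul_div_le T w)
  have hmono := strictMono_shiftedGrid (w := w) (by lia)
  have hrange := one_le_shiftedGrid_and_lt (w := w) (by lia) hnT
  have hspacing (j : Option ℕ) := le_minSpacing_stair (δ := δ) (by lia) (by lia)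
    (shiftedGrid_add_le (by lia) j) (le_shiftedGrid_and_add_le (by lia) hnT j)
  have hdet (j : Option ℕ) : Detectable C T (stair δ (T / w - 2) (shiftedGrid w j)) := by
    refine detectable_stair (by lia) (by lia) (shiftedGrid_add_le (by lia) j)
      (le_shiftedGrid_and_add_le (by lia) hnT j) ?_
    rw [hδ_sq, Nat.cast_sub (by lia), Nat.cast_one]
    nlinarith
  have hmeas : MeasurableSet {x | Accurate T (stair δ (T / w - 2) (shiftedGrid w none)) (est x)
      (1 / 8 * Real.log T)} :=
    measurableSet_preimage_of_countable hest {S | Accurate T _ S (1 / 8 * Real.log T)}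
  rcases law_le_or_exists_law_le_of_bump (δ := -δ) (u := 1) (by lia) (by lia) hT
      (by rw [neg_sq, hδ_sq, Nat.cast_one, one_mul]) (fun i => stair_shiftedGrid_sub δ i.2) hmeas
      (E := fun j => {x | Accurate T (stair δ (T / w - 2) (shiftedGrid w (some j))) (est x)
        (1 / 8 * Real.log T)}) fun j => Set.disjoint_left.2 fun x hx hx₀ => by
          have hne : shiftedGrid w (some j) j ≠ shiftedGrid w none j := by
            rw [shiftedGrid_self, shiftedGrid_none]; lia
          linarith [sq_le_of_accurate_stair_of_accurate_stair hδ.ne' (hmono _) (hrange _) hx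
            (hmono _) (hrange _) hx₀ j.2 hne]
    with h | ⟨j, hj⟩
  · exact ⟨_, le_trans (by lia) (hspacing none), hdet none, h⟩
  · exact ⟨_, le_trans (by lia) (hspacing (some j)), hdet (some j), hj⟩

end SeededBS

theorem theorem3 :
    -- consistency and localisation of seeded binary segmentation
    (∃ C₀ C₁ C₂ : ℝ, 0 < C₀ ∧ 0 < C₁ ∧ 0 < C₂ ∧
      ∀ a : ℝ, 1 / 2 ≤ a → a < 1 →
      ∀ m : ℕ → ℕ, (∀ T, 2 ≤ m T) →
      ∀ f : ℕ → ℕ → ℝ,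
        (∀ᶠ T in atTop, (m T : ℝ) ≤ a * (minSpacing T (f T) : ℝ) + 1) →
        (∀ᶠ T in atTop, Detectable C₀ T (f T)) →
        Tendsto
          (fun T : ℕ => law T (f T)
            {x | ∀ S, IsOutput a (m T) (C₁ * √(Real.log T)) x S →
              Accurate T (f T) S (C₂ * Real.log T)})
          atTop (nhds 1)) ∧
    -- optimality of the detection condition
    (∃ c₀ : ℝ, 0 < c₀ ∧ ∃ p : ENNReal, p < 1 ∧
      ∀ᶠ T : ℕ in atTop, ∀ Nhat : (Obs T → ℝ) → ℕ, Measurable Nhat →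
        ∃ f : ℕ → ℝ, 2 ≤ minSpacing T f ∧ Detectable c₀ T f ∧
          law T f {x | Nhat x = numChanges T f} ≤ p) ∧
    -- optimality of the localisation rate
    (∃ c₂ : ℝ, 0 < c₂ ∧ ∃ p : ENNReal, p < 1 ∧
      ∀ C : ℝ, 0 < C →
      ∀ᶠ T : ℕ in atTop, ∀ est : (Obs T → ℝ) → Finset ℕ,
        (∀ S, MeasurableSet (est ⁻¹' {S})) →
        ∃ f : ℕ → ℝ, 2 ≤ minSpacing T f ∧ Detectable C T f ∧
          law T f {x | Accurate T f (est x) (c₂ * Real.log T)} ≤ p) := by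
  refine ⟨⟨20736, 30, 216, by norm_num, by norm_num, by norm_num,
    fun a ha ha1 m hm2 f hm hdet => tendsto_law_accurate ha ha1 hm2 hm hdet⟩,
    ⟨1 / 2, by norm_num, ENNReal.ofReal (3 / 4), ?_, ?_⟩,
    ⟨1 / 8, by norm_num, ENNReal.ofReal (3 / 4), ?_, ?_⟩⟩
  · rw [ENNReal.ofReal_lt_one]; norm_num
  · filter_upwards [eventually_ge_atTop 196] with T hT Nhat hN
    exact detection_lower_bound hT hN
  · rw [ENNReal.ofReal_lt_one]; norm_num
  · intro C _
    filter_upwards [eventually_ge_atTop ((7 * (2 * ⌈C⌉₊ + 3)) ^ 2)] with T hT est hest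
    exact localisation_lower_bound (by lia) (by push_cast; linarith [Nat.le_ceil C]) hT hest
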